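/- Let $\mathcal T$ be a triangulated category (with suspension $X\mapsto X[1]$) with countable direct sums. An ideal $\mathfrak I$ in $\mathcal T$ is a family of subgroups $\mathfrak I(X,Y)\subseteq\mathcal T(X,Y)$ stable under composition with arbitrary morphisms; it is a stable homological ideal if it is the kernel on morphisms of a stable homological functor, that is, a homological functor to an abelian category with a suspension autoequivalence, together with natural isomorphisms making it compatible with suspensions. It is compatible with countable direct sums if $\bigoplus X_n\to Y$ lies in $\mathfrak I$ whenever all components $X_n\to Y$ do. An object $P$ is $\mathfrak I$-projective if $\mathcal T(P,f)=0$ for all $f\in\mathfrak I$; an object $B$ is $\mathfrak I$-contractible if $\mathrm{id}_B\in\mathfrak I$; there are enough $\mathfrak I$-projective objects if every $X\in\mathcal T$ admits an exact triangle $P\to X\xrightarrow{\iota} N\to P[1]$ with $P$ $\mathfrak I$-projective and $\iota\in\mathfrak I$. Let $\mathfrak I$ be a stable homological ideal in $\mathcal T$ that is compatible with countable direct sums and has enough projective objects. Let $F\colon\mathcal T\to\mathfrak A$ be the universal $\mathfrak I$-exact stable homological functor: $F$ is a stable homological functor to an abelian category $\mathfrak A$ with suspension, $F$ vanishes on $\mathfrak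 I$, and every stable homological functor $G\colon\mathcal T\to\mathfrak B$ vanishing on $\mathfrak I$ factors as $G\cong H\circ F$ for a stable exact functor $H\colon\mathfrak A\to\mathfrak B$ that is unique up to natural isomorphism. A lifting of $A\in\mathfrak A$ is a pair $(\hat A,\alpha)$ of an object $\hat A\in\mathcal T$ with $\mathcal T(\hat A,B)=0$ for all $\mathfrak I$-contractible $B$ and an isomorphism $\alpha\colon F(\hat A)\to A$. An equivalence from $(\hat A_1,\alpha_1)$ to $(\hat A_2,\alpha_2)$ is an isomorphism $\varphi\colon\hat A_1\to\hat A_2$ with $\alpha_1=\alpha_2\circ F(\varphi)$. **Theorem.** Let $A\in\mathfrak A$ have cohomological (projective) dimension at most $2$. Then the set of equivalence classes of liftings of $A$ is in bijection with $\operatorname{Ext}^2_{\mathfrak A}(A,A[-1])$. Moreover, the group $\operatorname{Ext}^2_{\mathfrak A}(A,A[-1])$ acts freely and transitively on this set in such a way that for any two liftings $(\hat A_1,\alpha_1)$, $(\hat A_2,\alpha_2)$ the class $\delta(\hat A_2,\hat A_1)\in\operatorname{Ext}^2_{\mathfrak A}(A,A[-1])$ carries the class of $(\hat A_1,\alpha_1)$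 to that of $(\hat A_2,\alpha_2)$. Here $\delta(\hat A_2,\hat A_1)$ is defined as follows. There are exact triangles $D\xrightarrow{\varphi_i}P\xrightarrow{\pi_i}\hat A_i\to D[1]$, $i=1,2$, with a common $D$ and a common $\mathfrak I$-projective $P$, such that $F(\varphi_1)=F(\varphi_2)$ and $p:=\alpha_1\circ F(\pi_1)=\alpha_2\circ F(\pi_2)$ is an epimorphism $F(P)\to A$; so there is an extension $F(D)\rightarrowtail F(P)\twoheadrightarrow A$. As $F(\varphi_2-\varphi_1)=0$, an exact triangle $P[-1]\to E\to D\xrightarrow{\varphi_2-\varphi_1}P$ gives an extension $F(P)[-1]\rightarrowtail F(E)\twoheadrightarrow F(D)$, that is, a class in $\operatorname{Ext}^1(F(D),F(P)[-1])$. Then $\delta(\hat A_2,\hat A_1)$ is the image of this class under $\operatorname{Ext}^1(F(D),F(P)[-1])\xrightarrow{p[-1]_*}\operatorname{Ext}^1(F(D),A[-1])\to\operatorname{Ext}^2(A,A[-1])$, where the second map is the Yoneda product with the class of the extension $F(D)\rightarrowtail F(P)\twoheadrightarrow A$. It does not depend on the choices. -/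

import Mathlib

open CategoryTheory CategoryTheory.Limits CategoryTheory.Pretriangulated CategoryTheory.Abelian

set_option linter.unusedSectionVars false

noncomputable section

namespace TriangulatedLifting

/-- An ideal in a preadditive category: a subgroup of each group of morphisms, stable under
composition with arbitrary morphisms on both sides. -/
structure MorphismIdeal (T : Type*) [Category T] [Preadditive T] where
  hom (X Y : T) : AddSubgroup (X ⟶ Y)
  precomp {X Y Z : T} (f : X ⟶ Y) {g : Y ⟶ Z} (hg : g ∈ hom Y Z) : f ≫ g ∈ hom X Z
  postcomp {X Y Z : T} {f : X ⟶ Y} (hf : f ∈ hom X Y) (g : Y ⟶ Z) : f ≫ g ∈ hom X Z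

section Ideals

universe w₁ w₂ v u

variable {T : Type u} [Category.{v} T] [Preadditive T] [HasZeroObject T] [HasShift T ℤ]
  [∀ n : ℤ, (shiftFunctor T n).Additive] [Pretriangulated T]

namespace MorphismIdeal

variable (I : MorphismIdeal T)

/-- `I` is a (stable) homological ideal: it is the kernel on morphisms of some stable homological
functor, that is, of a homological functor `G : T ⥤ B` into an abelian category with
a shift, together with a natural compatibility of `G` with the shifts. Such an ideal
is automatically invariant under the shifts of `T`. (The shift functors of `B` are
equivalences, hence automatically exact.) -/
def IsStableHomological : Prop :=
  ∃ (B : Type w₁) (_ : Category.{w₂} B) (_ : Abelian B) (_ : HasShift B ℤ)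
    (G : T ⥤ B) (_ : G.CommShift ℤ) (_ : G.IsHomological),
    ∀ ⦃X Y : T⦄ (f : X ⟶ Y), f ∈ I.hom X Y ↔ G.map f = 0

/-- `I` is compatible with countable coproducts: the isomorphism between `T(⨁ Xₙ, Y)` and
`∏ T(Xₙ, Y)` maps `I(⨁ Xₙ, Y)` onto `∏ I(Xₙ, Y)` (one inclusion holds for every ideal). -/
def CompatibleWithCountableCoproducts [HasCountableCoproducts T] : Prop :=
  ∀ ⦃X : ℕ → T⦄ ⦃Y : T⦄ (f : ∀ n, X n ⟶ Y),
    (∀ n, f n ∈ I.hom (X n) Y) → Sigma.desc f ∈ I.hom (∐ X) Y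

/-- `P` is `I`-projective: the functor `T(P, -)` vanishes on `I`. -/
def IsProjectiveObj (P : T) : Prop :=
  ∀ ⦃X Y : T⦄ (g : P ⟶ X) (f : X ⟶ Y), f ∈ I.hom X Y → g ≫ f = 0

/-- `B` is `I`-contractible: its identity morphism lies in `I`. -/
def IsContractibleObj (B : T) : Prop := 𝟙 B ∈ I.hom B B

/-- `f` is `I`-epic: in an exact triangle `X ⟶ Y ⟶ C ⟶ X⟦1⟧` on `f`,
the map `Y ⟶ C` lies in `I`. -/
def IsEpicMor {X Y : T} (f : X ⟶ Y) : Prop :=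
  ∃ (C : T) (g : Y ⟶ C) (h : C ⟶ X⟦(1 : ℤ)⟧),
    Triangle.mk f g h ∈ distTriang T ∧ g ∈ I.hom Y C

/-- There are enough `I`-projective objects. -/
def EnoughProjectiveObjs : Prop :=
  ∀ X : T, ∃ (P : T) (π : P ⟶ X), I.IsProjectiveObj P ∧ I.IsEpicMor π

end MorphismIdeal

end Ideals

section Universal

universe v' u' v u

variable {T : Type u} [Category.{v} T] [Preadditive T] [HasZeroObject T] [HasShift T ℤ]
  [∀ n : ℤ, (shiftFunctor T n).Additive] [Pretriangulated T]
  {𝔄 : Type u'} [Category.{v'} 𝔄] [Abelian 𝔄] [HasShift 𝔄 ℤ]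

/-- `F : T ⥤ 𝔄` is the universal `I`-exact stable homological functor: it kills `I`, and any
stable homological functor `G : T ⥤ B` that kills `I` factors as `F ⋙ H` (up to an
isomorphism compatible with the shifts) for a stable exact functor `H : 𝔄 ⥤ B`, which is
unique up to natural isomorphism. -/
structure IsUniversalExact (I : MorphismIdeal T) (F : T ⥤ 𝔄) [F.CommShift ℤ]
    [F.IsHomological] : Prop where
  map_eq_zero : ∀ ⦃X Y : T⦄ (f : X ⟶ Y), f ∈ I.hom X Y → F.map f = 0
  exists_factorization :
    ∀ (B : Type (max u v u' v')) [Category.{max u v u' v'} B] [Abelian B] [HasShift B ℤ]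
      (G : T ⥤ B) [G.CommShift ℤ] [G.IsHomological],
      (∀ ⦃X Y : T⦄ (f : X ⟶ Y), f ∈ I.hom X Y → G.map f = 0) →
      ∃ (H : 𝔄 ⥤ B) (_ : H.CommShift ℤ), PreservesFiniteLimits H ∧ PreservesFiniteColimits H ∧
        ∃ e : F ⋙ H ≅ G, NatTrans.CommShift e.hom ℤ
  factorization_unique :
    ∀ (B : Type (max u v u' v')) [Category.{max u v u' v'} B] [Abelian B] [HasShift B ℤ]
      (G : T ⥤ B) [G.CommShift ℤ] [G.IsHomological]
      (H₁ H₂ : 𝔄 ⥤ B) [H₁.CommShift ℤ] [H₂.CommShift ℤ]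
      [PreservesFiniteLimits H₁] [PreservesFiniteColimits H₁]
      [PreservesFiniteLimits H₂] [PreservesFiniteColimits H₂]
      (e₁ : F ⋙ H₁ ≅ G) (e₂ : F ⋙ H₂ ≅ G),
      NatTrans.CommShift e₁.hom ℤ → NatTrans.CommShift e₂.hom ℤ → Nonempty (H₁ ≅ H₂)

end Universal

section Liftings

universe w v' u' v u

variable {T : Type u} [Category.{v} T] [Preadditive T] [HasZeroObject T] [HasShift T ℤ]
  [∀ n : ℤ, (shiftFunctor T n).Additive] [Pretriangulated T]
  {𝔄 : Type u'} [Category.{v'} 𝔄] [Abelian 𝔄] [HasShift 𝔄 ℤ]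

/-- A lifting of `A`: an object `obj` of `T` with `T(obj, B) = 0` for all `I`-contractible `B`,
together with an isomorphism `F(obj) ≅ A`. -/
structure Lifting (I : MorphismIdeal T) (F : T ⥤ 𝔄) (A : 𝔄) where
  obj : T
  orthogonal : ∀ ⦃B : T⦄, I.IsContractibleObj B → ∀ f : obj ⟶ B, f = 0
  iso : F.obj obj ≅ A

/-- Equivalence of liftings: an isomorphism in `T` compatible with the identifications
with `A`. -/
instance Lifting.setoid (I : MorphismIdeal T) (F : T ⥤ 𝔄) (A : 𝔄) :
    Setoid (Lifting I F A) where
  r L₁ L₂ := ∃ φ : L₁.obj ≅ L₂.obj, F.map φ.hom ≫ L₂.iso.hom = L₁.iso.hom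
  iseqv :=
    { refl := fun L => ⟨Iso.refl _, by simp⟩
      symm := by
        rintro L₁ L₂ ⟨φ, h⟩
        exact ⟨φ.symm, by rw [← h, ← Category.assoc, ← F.map_comp]; simp⟩
      trans := by
        rintro L₁ L₂ L₃ ⟨φ, h⟩ ⟨ψ, h'⟩
        exact ⟨φ ≪≫ ψ, by simp [h, h']⟩ }

/-- The equivalence classes of liftings of `A`. -/
def LiftingClass (I : MorphismIdeal T) (F : T ⥤ 𝔄) (A : 𝔄) : Type (max u v') :=
  Quotient (Lifting.setoid I F A)

/-- The equivalence class of a lifting. -/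
def LiftingClass.mk {I : MorphismIdeal T} {F : T ⥤ 𝔄} {A : 𝔄} (L : Lifting I F A) :
    LiftingClass I F A :=
  Quotient.mk (Lifting.setoid I F A) L

variable (F : T ⥤ 𝔄) [F.CommShift ℤ] [F.IsHomological]

/-- A stable homological functor kills all shifts of a morphism that it kills. -/
lemma map_shift_eq_zero {X Y : T} {f : X ⟶ Y} (hf : F.map f = 0) (n : ℤ) :
    F.map (f⟦n⟧') = 0 := by
  have h := (F.commShiftIso n).hom.naturality f
  dsimp at h
  rw [hf] at h
  have h0 : (0 : F.obj X ⟶ F.obj Y)⟦n⟧' = 0 := Functor.map_zero _ _ _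
  rw [h0, comp_zero] at h
  exact (cancel_mono ((F.commShiftIso n).hom.app Y)).1 (by rw [h, zero_comp])

/-- A stable homological functor that kills the third map of an exact triangle
`X ⟶ Y ⟶ Z ⟶ X⟦1⟧` maps it to a short exact sequence `F X ⟶ F Y ⟶ F Z`. -/
lemma shortExact_of_map_eq_zero (S : Triangle T) (hS : S ∈ distTriang T)
    (h : F.map S.mor₃ = 0) : ((shortComplexOfDistTriangle S hS).map F).ShortExact := by
  have h₂ := F.map_distinguished_exact S hS
  have h₃ := F.map_distinguished_exact _ (rot_of_distTriang _ hS)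
  have h₁ := F.map_distinguished_exact _ (inv_rot_of_distTriang _ hS)
  have e : Epi ((shortComplexOfDistTriangle S hS).map F).g := h₃.epi_f h
  have m : Mono ((shortComplexOfDistTriangle S hS).map F).f := by
    refine h₁.mono_g ?_
    have h' : F.map (-(S.mor₃⟦(-1 : ℤ)⟧' ≫ (shiftEquiv T (1 : ℤ)).unitIso.inv.app S.obj₁)) = 0 :=
      (F.map_neg).trans (neg_eq_zero.2
        ((F.map_comp _ _).trans ((congrArg (· ≫ _) (map_shift_eq_zero F h (-1))).trans zero_comp)))
    exact h'
  exact { exact := h₂ }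

/-- The exact triangle `Y⟦-1⟧ ⟶ E ⟶ X ⟶ Y` associated to a morphism `X ⟶ Y`. -/
lemma exists_fibre_triangle {X Y : T} (f : X ⟶ Y) :
    ∃ S : (E : T) × (Y⟦(-1 : ℤ)⟧ ⟶ E) × (E ⟶ X),
      Triangle.mk S.2.1 S.2.2
        (f ≫ (shiftFunctorCompIsoId T (-1 : ℤ) 1 (by simp)).inv.app Y) ∈ distTriang T := by
  obtain ⟨E, i, p, h⟩ := distinguished_cocone_triangle₂
    (f ≫ (shiftFunctorCompIsoId T (-1 : ℤ) 1 (by simp)).inv.app Y)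
  exact ⟨⟨E, i, p⟩, h⟩

/-- A choice of the exact triangle `Y⟦-1⟧ ⟶ E ⟶ X ⟶ Y` on `f : X ⟶ Y`, with `Y` written as
`Y⟦-1⟧⟦1⟧`. -/
def fibreTriangle {X Y : T} (f : X ⟶ Y) : Triangle T :=
  Triangle.mk (exists_fibre_triangle f).choose.2.1 (exists_fibre_triangle f).choose.2.2
    (f ≫ (shiftFunctorCompIsoId T (-1 : ℤ) 1 (by simp)).inv.app Y)

lemma fibreTriangle_distinguished {X Y : T} (f : X ⟶ Y) :
    fibreTriangle f ∈ distTriang T :=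
  (exists_fibre_triangle f).choose_spec

lemma fibreTriangle_shortExact {X Y : T} (f : X ⟶ Y) (hf : F.map f = 0) :
    ((shortComplexOfDistTriangle _ (fibreTriangle_distinguished f)).map F).ShortExact :=
  shortExact_of_map_eq_zero F _ _
    ((F.map_comp _ _).trans ((congrArg (· ≫ _) hf).trans zero_comp))

/-- The map `{f ∈ T(X, Y) | F(f) = 0} ⟶ Ext¹(F(X), F(Y)⟦-1⟧)` of the universal coefficient
sequence: a morphism `f` with `F(f) = 0` is sent to the class of the extension
`F(Y)⟦-1⟧ ≅ F(Y⟦-1⟧) ⟶ F(E) ⟶ F(X)` got from an exact triangle `Y⟦-1⟧ ⟶ E ⟶ X ⟶ Y`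
on `f`. -/
def extensionClass [HasExt.{w} 𝔄] {X Y : T} (f : X ⟶ Y) (hf : F.map f = 0) :
    Ext.{w} (F.obj X) ((F.obj Y)⟦(-1 : ℤ)⟧) 1 :=
  (show Ext.{w} (F.obj X) (F.obj (Y⟦(-1 : ℤ)⟧)) 1 from
    (fibreTriangle_shortExact F f hf).extClass).comp
      (Ext.mk₀ ((F.commShiftIso (-1 : ℤ)).hom.app Y)) (add_zero 1)

variable {I : MorphismIdeal T} {F} {A : 𝔄}

/-- A presentation of two liftings `L₁`, `L₂` of `A` as cones of two morphisms
`φ₁, φ₂ : D ⟶ P` with the same source and the same target, where `P` is `I`-projective and the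
two maps `F(P) ⟶ A` agree and are epic and `F(φ₁) = F(φ₂)` (the inclusion of the kernel of
`F(P) ⟶ A`). -/
structure Comparison (L₁ L₂ : Lifting I F A) where
  D : T
  P : T
  projective : I.IsProjectiveObj P
  φ₁ : D ⟶ P
  φ₂ : D ⟶ P
  π₁ : P ⟶ L₁.obj
  π₂ : P ⟶ L₂.obj
  δ₁ : L₁.obj ⟶ D⟦(1 : ℤ)⟧
  δ₂ : L₂.obj ⟶ D⟦(1 : ℤ)⟧
  distinguished₁ : Triangle.mk φ₁ π₁ δ₁ ∈ distTriang T
  distinguished₂ : Triangle.mk φ₂ π₂ δ₂ ∈ distTriang T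
  map_φ : F.map φ₁ = F.map φ₂
  map_π : F.map π₁ ≫ L₁.iso.hom = F.map π₂ ≫ L₂.iso.hom
  /-- `F(π₁)` is epic -/
  map_δ₁ : F.map δ₁ = 0

namespace Comparison

variable {L₁ L₂ : Lifting I F A} (c : Comparison L₁ L₂)

/-- The short exact sequence `F(D) ⟶ F(P) ⟶ F(L₁)`. -/
lemma shortExact :
    ((shortComplexOfDistTriangle _ c.distinguished₁).map F).ShortExact :=
  shortExact_of_map_eq_zero F _ _ c.map_δ₁

lemma map_sub : F.map (c.φ₂ - c.φ₁) = 0 := by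
  rw [F.map_sub, c.map_φ, sub_self]

/-- The map `F(P) ⟶ A`. -/
def toA : F.obj c.P ⟶ A := F.map c.π₁ ≫ L₁.iso.hom

/-- The class in `Ext¹(A, F(D))` of the extension `F(D) ⟶ F(P) ⟶ A`. -/
def syzygyClass [HasExt.{w} 𝔄] : Ext.{w} A (F.obj c.D) 1 :=
  (Ext.mk₀ L₁.iso.inv).comp
    (show Ext.{w} (F.obj L₁.obj) (F.obj c.D) 1 from c.shortExact.extClass) (zero_add 1)

/-- The relative obstruction class of `L₂` and `L₁`: the image of `φ₂ - φ₁` under the maps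
`Ext¹(F(D), F(P)⟦-1⟧) ⟶ Ext¹(F(D), A⟦-1⟧) ⟶ Ext²(A, A⟦-1⟧)`, the first one induced by
`F(P) ⟶ A`, the second one the connecting map of the extension `F(D) ⟶ F(P) ⟶ A`. -/
def obstructionClass [HasExt.{w} 𝔄] : Ext.{w} A (A⟦(-1 : ℤ)⟧) 2 :=
  c.syzygyClass.comp
    ((extensionClass F (c.φ₂ - c.φ₁) c.map_sub).comp
      (Ext.mk₀ (c.toA⟦(-1 : ℤ)⟧')) (add_zero 1)) (by norm_num)

end Comparison

end Liftings

end TriangulatedLifting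

end

open TriangulatedLifting

universe w w₁ w₂ v' u' v u

/-!
# Liftings of objects of projective dimension two

The argument has two halves: concrete information about `F` is extracted from its universal
property, and liftings are then compared through their presentations as cones.

**Universality.** Three facts about an `I`-projective object `P` are needed: `F` induces bijections
`T(P, X) ≃ 𝔄(F(P), F(X))`, the object `F(P)` is projective, and every object of `𝔄` is a quotient of
some such `F(P)` (`ResolvesByProjectives`). Injectivity holds because `X ↦ (T(P, X⟦n⟧))ₙ` is a
stable homological functor that kills `I` and hence factors through `F`; it can be given values in
a small abelian category (`exists_stable_functor_detecting`). For the remaining facts, `F` is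
tested against an enlargement of `𝔄`: the category `Presented I F` of objects `A` with a
distinguished set of "liftable" morphisms `F(P) ⟶ A` that arises from a presentation of `A` as the
image of some `F(t)` with `I`-projective source. This category is abelian, the forgetful functor
to `𝔄` is exact and faithful, and `F` lifts to it by declaring the morphisms `F(s) : F(P) ⟶ F(X)`
liftable. By universality the lift factors through an exact functor `H : 𝔄 ⥤ Presented I F`, and
by uniqueness `H` is a section of the forgetful functor (`IsUniversalExact.exists_section`). So
every object of `𝔄` has a canonical set of liftable morphisms, preserved by all morphisms of `𝔄`.
The three facts follow: `H(h)` preserves the liftable morphism `𝟙`, liftable morphisms lift along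
epimorphisms, and each presented object is by definition a quotient of some `F(P)`.

**Universal coefficients.** Idempotents split in `T` because it has countable coproducts, and so
every projective object of `𝔄` comes from an `I`-projective object. An object `D` orthogonal to the
contractible objects, with `F(D)` of projective dimension at most one, is therefore the cone of
a morphism between `I`-projective objects. Hence `T(D, Y) ⟶ 𝔄(F(D), F(Y))` is surjective
(`ResolvesByProjectives.exists_map_eq`), and its kernel is mapped bijectively to
`Ext¹(F(D), F(Y)⟦-1⟧)` by the extension class. The extension class is additive and natural because
the extension of an exact triangle is natural in the outer objects (`triangleClass_naturality`).

**Liftings.** A lifting `L` of `A` is the cone of some `φ : D ⟶ P` with `P` `I`-projective and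
`F(D) ⟶ F(P) ⟶ A` exact. If `A` has projective dimension at most two, then `F(D)` has dimension at
most one, so all liftings of `A` are cones of morphisms `φ : D ⟶ P` with the same `D`, `P` and
`F(φ)`. The obstruction class `σ · [φ₂ - φ₁] · p⟦-1⟧` is then additive in the pair of liftings. It
is invariant under equivalence: a change of presentation alters `φ₂ - φ₁` by a morphism that factors
through some `φ`, and `F(φ)` composes to zero with `p`. It vanishes only if the liftings are
equivalent, because `σ` acts injectively and `[φ₂ ≫ π₁] = 0` forces `φ₂ ≫ π₁ = 0`. Every
class occurs, because `φ₁` may be changed by any `ψ` with `F(ψ) = 0`. An additive function of pairs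
with these properties is the difference function of a free and transitive action. Finally, a lifting
of `A` is constructed by lifting a projective resolution of length two.
-/

noncomputable section

namespace TriangulatedLifting

/-! ### A functor detecting the morphisms out of an object -/

section Detecting

universe v₁ u₁ v₂ u₂

section Subquotients

variable {C : Type u} [Category.{v} C] [Abelian C]

/-- The objects that are subquotients of objects satisfying `P`. -/
def subquotients (P : ObjectProperty C) : ObjectProperty C := fun M =>
  ∃ (X N : C) (i : N ⟶ X) (p : N ⟶ M), P X ∧ Mono i ∧ Epi p

variable (P : ObjectProperty C)

lemma le_subquotients : P ≤ subquotients P := fun X hX =>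
  ⟨X, X, 𝟙 X, 𝟙 X, hX, inferInstance, inferInstance⟩

instance : (subquotients P).IsClosedUnderSubobjects where
  prop_of_mono := by
    rintro M' M j _ ⟨X, N, i, p, hX, _, _⟩
    exact ⟨X, pullback p j, pullback.fst p j ≫ i, pullback.snd p j, hX, mono_comp _ _,
      inferInstance⟩

instance : (subquotients P).IsClosedUnderQuotients where
  prop_of_epi := by
    rintro M M' q _ ⟨X, N, i, p, hX, _, _⟩
    exact ⟨X, N, i, p ≫ q, hX, inferInstance, epi_comp _ _⟩

instance [P.ContainsZero] : (subquotients P).ContainsZero where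
  exists_zero := by
    obtain ⟨Z, hZ, hP⟩ := ObjectProperty.ContainsZero.exists_zero (P := P)
    exact ⟨Z, hZ, le_subquotients P _ hP⟩

instance [P.IsClosedUnderBinaryProducts] : (subquotients P).IsClosedUnderBinaryProducts where
  limitsOfShape_le := by
    rintro M ⟨pres⟩
    obtain ⟨X₁, N₁, i₁, p₁, h₁, _, _⟩ := pres.prop_diag_obj ⟨WalkingPair.left⟩
    obtain ⟨X₂, N₂, i₂, p₂, h₂, _, _⟩ := pres.prop_diag_obj ⟨WalkingPair.right⟩
    have key : subquotients P (pres.diag.obj ⟨.left⟩ ⊞ pres.diag.obj ⟨.right⟩) :=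
      ⟨X₁ ⊞ X₂, N₁ ⊞ N₂, biprod.map i₁ i₂, biprod.map p₁ p₂,
        P.prop_of_isLimit_binaryFan (BinaryBiproduct.isLimit X₁ X₂) h₁ h₂, inferInstance,
        inferInstance⟩
    refine (subquotients P).prop_of_iso ?_ key
    exact (BinaryBiproduct.isLimit _ _).conePointUniqueUpToIso
      ((IsLimit.postcomposeHomEquiv (diagramIsoPair pres.diag) _).symm pres.isLimit)

instance essentiallySmall_subquotients [LocallySmall.{w} C] [WellPowered.{w} C]
    [ObjectProperty.EssentiallySmall.{w} P] :
    ObjectProperty.EssentiallySmall.{w} (subquotients P) := by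
  obtain ⟨Q, _, hQP, hPQ⟩ := ObjectProperty.EssentiallySmall.exists_small_le.{w} P
  let ι := Σ (X : Subtype Q) (N : Subobject X.1), Subobject (N : C)
  let ob : ι → C := fun x => cokernel x.2.2.arrow
  refine ⟨.ofObj ob, inferInstance, ?_⟩
  rintro M ⟨X, N, i, p, hX, _, _⟩
  obtain ⟨X', hX', ⟨e⟩⟩ := hPQ _ hX
  let S : Subobject X' := Subobject.mk (i ≫ e.hom)
  let eS : (S : C) ≅ N := Subobject.underlyingIso _
  refine ⟨ob ⟨⟨X', hX'⟩, S, Subobject.mk (kernel.ι (eS.hom ≫ p))⟩, ⟨_⟩, ⟨?_⟩⟩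
  have h1 : IsColimit (CokernelCofork.ofπ (eS.hom ≫ p) (kernel.condition _)) :=
    Abelian.epiIsCokernelOfKernel _ (limit.isLimit _)
  have e1 : M ≅ cokernel (kernel.ι (eS.hom ≫ p)) :=
    h1.coconePointUniqueUpToIso (colimit.isColimit _)
  exact e1 ≪≫ cokernel.mapIso _ _ (Subobject.underlyingIso _).symm (Iso.refl _) (by simp)

end Subquotients

lemma exists_small_abelian (C : Type u) [Category.{v} C] [Abelian C] [EssentiallySmall.{w} C] :
    ∃ (D : Type w) (_ : SmallCategory D) (_ : Abelian D), Nonempty (C ≌ D) := by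
  let E := equivSmallModel.{w} C
  let _ : Preadditive (SmallModel.{w} C) := .ofFullyFaithful E.fullyFaithfulInverse
  have : HasFiniteProducts (SmallModel.{w} C) :=
    ⟨fun n => Adjunction.hasLimitsOfShape_of_equivalence E.inverse⟩
  exact ⟨SmallModel.{w} C, inferInstance, abelianOfEquivalence E.inverse, ⟨E⟩⟩

lemma isClosedUnderBinaryProducts_essImage {T : Type u} [Category.{v} T] [Preadditive T]
    [HasBinaryBiproducts T]
    {C : Type u₁} [Category.{v₁} C] [Abelian C] (F : T ⥤ C) [F.Additive] :
    F.essImage.IsClosedUnderBinaryProducts where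
  limitsOfShape_le := by
    rintro M ⟨pres⟩
    have := preservesBinaryBiproducts_of_preservesBiproducts F
    obtain ⟨X₁, ⟨e₁⟩⟩ := pres.prop_diag_obj ⟨WalkingPair.left⟩
    obtain ⟨X₂, ⟨e₂⟩⟩ := pres.prop_diag_obj ⟨WalkingPair.right⟩
    refine ⟨X₁ ⊞ X₂, ⟨F.mapBiprod _ _ ≪≫ biprod.mapIso e₁ e₂ ≪≫
      (BinaryBiproduct.isLimit _ _).conePointUniqueUpToIso
      ((IsLimit.postcomposeHomEquiv (diagramIsoPair pres.diag) _).symm pres.isLimit)⟩⟩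

/-- Exactness in the target can be tested after a faithful exact functor. -/
lemma isHomological_of_comp {T : Type u} [Category.{v} T] [Preadditive T] [HasZeroObject T]
    [HasShift T ℤ] [∀ n : ℤ, (shiftFunctor T n).Additive] [Pretriangulated T]
    {B : Type u₁} [Category.{v₁} B] [Abelian B] {A : Type u₂} [Category.{v₂} A] [Abelian A]
    (G : T ⥤ B) (K : B ⥤ A) [K.Faithful] [PreservesFiniteLimits K] [PreservesFiniteColimits K]
    [K.PreservesZeroMorphisms]
    [(G ⋙ K).IsHomological] : G.IsHomological where
  map_zero X Y := K.map_injective (((G ⋙ K).map_zero X Y).trans (K.map_zero _ _).symm)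
  exact S hS := by
    have : G.PreservesZeroMorphisms :=
      ⟨fun X Y => K.map_injective (((G ⋙ K).map_zero X Y).trans (K.map_zero _ _).symm)⟩
    exact K.reflects_exact_of_faithful _ ((G ⋙ K).map_distinguished_exact S hS)

section

variable {T : Type u} [Category.{v} T] [Preadditive T] [HasZeroObject T] [HasShift T ℤ]
  [∀ n : ℤ, (shiftFunctor T n).Additive] [Pretriangulated T]

open ZeroObject in
/-- The functor `T(Q, -)` factors through a small abelian category in any sufficiently large
universe, because the subquotients of the groups `T(Q, X)` form an essentially small abelian
category. -/
lemma exists_small_functor (Q : T) :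
    ∃ (D : Type (max u v w)) (_ : SmallCategory D) (_ : Abelian D) (G : T ⥤ D)
      (_ : G.IsHomological),
      ∀ ⦃X Y : T⦄ (f : X ⟶ Y), G.map f = 0 ↔ ∀ g : Q ⟶ X, g ≫ f = 0 := by
  let F : T ⥤ AddCommGrpCat.{v} := preadditiveCoyoneda.obj (Opposite.op Q)
  have hF : F.IsHomological :=
    inferInstanceAs (preadditiveCoyoneda.obj (Opposite.op Q)).IsHomological
  have : WellPowered.{max u v w} AddCommGrpCat.{v} := ⟨fun X => small_lift.{v + 1, max u w, v} _⟩
  have := isClosedUnderBinaryProducts_essImage F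
  have : F.essImage.ContainsZero := ⟨⟨F.obj 0, F.map_isZero (isZero_zero T), ⟨_, ⟨Iso.refl _⟩⟩⟩⟩
  let S := subquotients F.essImage
  have : S.IsClosedUnderFiniteProducts := .mk'
  obtain ⟨D, _, _, ⟨E⟩⟩ := exists_small_abelian.{max u v w} S.FullSubcategory
  let G₀ : T ⥤ S.FullSubcategory := S.lift F (fun X => le_subquotients _ _ ⟨X, ⟨Iso.refl _⟩⟩)
  have := S.preservesKernels_ι
  have := S.preservesCokernels_ι
  have := Functor.preservesFiniteLimits_of_preservesKernels S.ι
  have := Functor.preservesFiniteColimits_of_preservesCokernels S.ι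
  let K : D ⥤ AddCommGrpCat.{v} := E.inverse ⋙ S.ι
  let e : (G₀ ⋙ E.functor) ⋙ K ≅ F :=
    Functor.isoWhiskerLeft G₀ (Functor.isoWhiskerRight E.unitIso.symm S.ι)
  have : ((G₀ ⋙ E.functor) ⋙ K).IsHomological := .of_iso e.symm
  refine ⟨D, inferInstance, inferInstance, G₀ ⋙ E.functor, isHomological_of_comp _ K, ?_⟩
  intro X Y f
  have h1 : (G₀ ⋙ E.functor).map f = 0 ↔ F.map f = 0 := by
    rw [← K.map_eq_zero_iff]
    have := e.hom.naturality f
    constructor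
    · intro h
      rw [← cancel_epi (e.hom.app X), ← this, Functor.comp_map, h, zero_comp, comp_zero]
    · intro h
      rw [h, comp_zero] at this
      exact (cancel_mono (e.hom.app Y)).1 (this.trans zero_comp.symm)
  rw [h1]
  constructor
  · intro h g
    exact ConcreteCategory.congr_hom h g
  · intro h
    ext g
    exact h g

end

section Graded

variable (D : Type u) [Category.{v} D]

/-- The shift by reindexing on `ℤ`-graded objects. -/
def gradedShiftCore : ShiftMkCore (Discrete ℤ ⥤ D) ℤ where
  F n := (Functor.whiskeringLeft _ _ _).obj (Discrete.functor fun m => Discrete.mk (n + m))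
  zero := NatIso.ofComponents (fun M => Discrete.natIso fun m =>
    M.mapIso (eqToIso (by simp)))
  add a b := NatIso.ofComponents (fun M => Discrete.natIso fun m =>
    M.mapIso (eqToIso (by simp [add_assoc])))
  assoc_hom_app a b c X := by ext; simp [eqToHom_app, eqToHom_map]
  zero_add_hom_app n X := by ext; simp [eqToHom_app, eqToHom_map]
  add_zero_hom_app n X := by ext; simp [eqToHom_app, eqToHom_map]

end Graded

lemma shiftIso_hom_app_eqToHom {T : Type u} [Category.{v} T] [HasShift T ℤ]
    {D : Type u₁} [Category.{v₁} D] (F : T ⥤ D) [F.ShiftSequence ℤ] (n a a' a'' : ℤ)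
    (h : n + a = a') (h' : a' = a'') (X : T) :
    (F.shiftIso n a a' h).hom.app X ≫ eqToHom (by rw [h']) =
      (F.shiftIso n a a'' (h.trans h')).hom.app X := by
  subst h'; simp

/-- The `ℤ`-graded functor `X ↦ (F(X⟦n⟧))ₙ`. -/
def gradedFunctor {T : Type u} [Category.{v} T] [HasShift T ℤ]
    {D : Type u₁} [Category.{v₁} D] (F : T ⥤ D) [F.ShiftSequence ℤ] : T ⥤ (Discrete ℤ ⥤ D) where
  obj X := Discrete.functor fun n => (F.shift n).obj X
  map f := Discrete.natTrans fun n => (F.shift n.as).map f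

/-- The functor `X ↦ (F(X⟦n⟧))ₙ` commutes with the shifts, which act on graded objects by
reindexing. -/
@[reducible]
def gradedFunctorCommShift {T : Type u} [Category.{v} T] [HasShift T ℤ]
    {D : Type u₁} [Category.{v₁} D] (F : T ⥤ D) [F.ShiftSequence ℤ] :
    letI := hasShiftMk _ _ (gradedShiftCore D)
    (gradedFunctor F).CommShift ℤ :=
  letI := hasShiftMk _ _ (gradedShiftCore D)
  { commShiftIso n := NatIso.ofComponents (fun X => Discrete.natIso fun m =>
      (F.shiftIso n m.as (n + m.as) rfl).app X) (by
        intro X Y f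
        ext m
        exact F.shiftIso_hom_naturality n m.as (n + m.as) rfl f)
    commShiftIso_zero := by
      ext X m
      rw [Functor.CommShift.isoZero_hom_app]
      change (F.shiftIso 0 m.as (0 + m.as) rfl).hom.app X =
        (F.shift m.as).map ((shiftFunctorZero T ℤ).hom.app X) ≫
          (Discrete.functor fun n => (F.shift n).obj X).map (eqToHom (by simp))
      rw [eqToHom_map, ← F.shiftIso_zero_hom_app, shiftIso_hom_app_eqToHom]
      exact (zero_add _).symm
    commShiftIso_add a b := by
      ext X m
      rw [Functor.CommShift.isoAdd_hom_app]
      change (F.shiftIso (a + b) m.as (a + b + m.as) rfl).hom.app X =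
        (F.shift m.as).map ((shiftFunctorAdd T a b).hom.app X) ≫
          (F.shiftIso b m.as (b + m.as) rfl).hom.app ((shiftFunctor T a).obj X) ≫
            (F.shiftIso a (b + m.as) (a + (b + m.as)) rfl).hom.app X ≫
          (Discrete.functor fun n => (F.shift n).obj X).map (eqToHom (by simp [add_assoc]))
      rw [eqToHom_map, shiftIso_hom_app_eqToHom _ _ _ _ _ _ (add_assoc _ _ _).symm,
        ← F.shiftIso_add_hom_app] }

/-- Exactness in a functor category is tested pointwise. -/
lemma exact_of_evaluation {J : Type u} [Category.{v} J] {D : Type u₁} [Category.{v₁} D] [Abelian D]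
    (S : ShortComplex (J ⥤ D)) (h : ∀ j, (S.map ((evaluation J D).obj j)).Exact) : S.Exact := by
  rw [ShortComplex.exact_iff_isZero_homology]
  refine Functor.isZero _ fun j => ?_
  exact ((ShortComplex.exact_iff_isZero_homology _).1 (h j)).of_iso
    (S.mapHomologyIso ((evaluation J D).obj j)).symm

/-- A stable homological functor with values in a small abelian category whose kernel consists of
the morphisms `f` such that `T(Q, f⟦n⟧) = 0` for all `n`: the graded functor with components
`T(Q, X⟦n⟧)`. -/
lemma exists_stable_functor_detecting {T : Type u} [Category.{v} T] [Preadditive T]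
    [HasZeroObject T] [HasShift T ℤ] [∀ n : ℤ, (shiftFunctor T n).Additive] [Pretriangulated T]
    (Q : T) :
    ∃ (B : Type (max u v w)) (_ : SmallCategory B) (_ : Abelian B) (_ : HasShift B ℤ)
      (G : T ⥤ B) (_ : G.CommShift ℤ) (_ : G.IsHomological),
      ∀ ⦃X Y : T⦄ (f : X ⟶ Y), G.map f = 0 ↔ ∀ (n : ℤ) (g : Q ⟶ X⟦n⟧), g ≫ f⟦n⟧' = 0 := by
  obtain ⟨D, _, _, F, _, hF⟩ := exists_small_functor.{w} Q
  let _ : F.ShiftSequence ℤ := Functor.ShiftSequence.tautological F ℤ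
  let _ := hasShiftMk _ _ (gradedShiftCore D)
  let _ := gradedFunctorCommShift F
  refine ⟨Discrete ℤ ⥤ D, inferInstance, inferInstance, inferInstance, gradedFunctor F,
    inferInstance, ?_, ?_⟩
  · have : (gradedFunctor F).PreservesZeroMorphisms :=
      ⟨fun X Y => by ext n; exact (F.shift n.as).map_zero X Y⟩
    exact ⟨fun S hS => exact_of_evaluation _ fun n => F.homologySequence_exact₂ S hS n.as⟩
  · intro X Y f
    have h1 : (gradedFunctor F).map f = 0 ↔ ∀ n : ℤ, F.map (f⟦n⟧') = 0 :=
      ⟨fun h n => NatTrans.congr_app h (Discrete.mk n),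
        fun h => by ext n; exact h n.as⟩
    rw [h1]
    exact forall_congr' fun n => hF _

end Detecting

section Presented

variable {T : Type u} [Category.{v} T] [Preadditive T] [HasZeroObject T] [HasShift T ℤ]
  [∀ n : ℤ, (shiftFunctor T n).Additive] [Pretriangulated T]
  {𝔄 : Type u'} [Category.{v'} 𝔄] [Abelian 𝔄]

/-! ### Objects with liftable morphisms -/

/-- There are enough `I`-projective objects, they are stable under the shifts, and the functor `F`
kills `I` and is faithful on morphisms out of `I`-projective objects. -/
structure DetectsProjectives (I : MorphismIdeal T) (F : T ⥤ 𝔄) : Prop where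
  enough : I.EnoughProjectiveObjs
  map_eq_zero : ∀ ⦃X Y : T⦄ (f : X ⟶ Y), f ∈ I.hom X Y → F.map f = 0
  eq_zero : ∀ ⦃P X : T⦄, I.IsProjectiveObj P → ∀ t : P ⟶ X, F.map t = 0 → t = 0
  shift : ∀ ⦃P : T⦄, I.IsProjectiveObj P → ∀ n : ℤ, I.IsProjectiveObj (P⟦n⟧)

namespace MorphismIdeal

variable {I : MorphismIdeal T}

lemma IsProjectiveObj.biprod {P Q : T} (hP : I.IsProjectiveObj P) (hQ : I.IsProjectiveObj Q) :
    I.IsProjectiveObj (P ⊞ Q) := fun X Y g f hf => by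
  apply biprod.hom_ext'
  · rw [← Category.assoc, hP _ _ hf, comp_zero]
  · rw [← Category.assoc, hQ _ _ hf, comp_zero]

/-- A morphism from an `I`-projective object lifts along `I`-epic maps. -/
lemma IsEpicMor.exists_lift {X Y P : T} {f : X ⟶ Y} (hf : I.IsEpicMor f)
    (hP : I.IsProjectiveObj P) (s : P ⟶ Y) : ∃ s' : P ⟶ X, s = s' ≫ f := by
  obtain ⟨C, g, h, hT, hg⟩ := hf
  exact Triangle.coyoneda_exact₂ _ hT s (hP s g hg)

end MorphismIdeal

lemma exists_lift_of_distTriang {X Y Z W : T} {f : X ⟶ Y} {g : Y ⟶ Z} {h : Z ⟶ X⟦(1 : ℤ)⟧}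
    (hT : Triangle.mk f g h ∈ distTriang T) (s : W ⟶ Y) (hs : s ≫ g = 0) :
    ∃ s' : W ⟶ X, s = s' ≫ f :=
  Triangle.coyoneda_exact₂ _ hT s hs

lemma exists_desc_of_distTriang {X Y Z W : T} {f : X ⟶ Y} {g : Y ⟶ Z} {h : Z ⟶ X⟦(1 : ℤ)⟧}
    (hT : Triangle.mk f g h ∈ distTriang T) (s : Y ⟶ W) (hs : f ≫ s = 0) :
    ∃ s' : Z ⟶ W, s = g ≫ s' :=
  Triangle.yoneda_exact₂ _ hT s hs

lemma exact_up_to_refinements_of_distTriang (F : T ⥤ 𝔄) [F.IsHomological] {X Y Z : T} {f : X ⟶ Y}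
    {g : Y ⟶ Z} {h : Z ⟶ X⟦(1 : ℤ)⟧} (hT : Triangle.mk f g h ∈ distTriang T) {A : 𝔄}
    (x : A ⟶ F.obj Y) (hx : x ≫ F.map g = 0) :
    ∃ (A' : 𝔄) (π : A' ⟶ A) (_ : Epi π) (y : A' ⟶ F.obj X), π ≫ x = y ≫ F.map f :=
  (F.map_distinguished_exact _ hT).exact_up_to_refinements x hx

/-- A criterion for factoring through an epimorphism `g` when the exactness of `f` and `g` is
given in terms of generalized elements. -/
lemma exists_desc_of_exact_up_to_refinements {A B C D : 𝔄} (f : A ⟶ B) (g : B ⟶ C) [Epi g]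
    (hfg : f ≫ g = 0) (H : ∀ ⦃Z : 𝔄⦄ (x : Z ⟶ B), x ≫ g = 0 →
      ∃ (Z' : 𝔄) (π : Z' ⟶ Z) (_ : Epi π) (y : Z' ⟶ A), π ≫ x = y ≫ f)
    (k : B ⟶ D) (hk : f ≫ k = 0) : ∃ l : C ⟶ D, g ≫ l = k := by
  have : (ShortComplex.mk f g hfg).Exact := by
    rw [ShortComplex.exact_iff_exact_up_to_refinements]
    exact fun Z x hx => H x hx
  exact ⟨this.desc k hk, this.g_desc k hk⟩

namespace DetectsProjectives

variable {I : MorphismIdeal T} {F : T ⥤ 𝔄} [F.IsHomological]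

lemma epi_map (hF : DetectsProjectives I F) {X Y : T} {f : X ⟶ Y} (hf : I.IsEpicMor f) :
    Epi (F.map f) := by
  obtain ⟨C, g, h, hT, hg⟩ := hf
  exact (F.map_distinguished_exact _ hT).epi_f (hF.map_eq_zero g hg)

/-- A morphism in `T` has a weak kernel with respect to maps from `I`-projective objects, which
is sent to an exact sequence. -/
lemma exists_weakKernel (hF : DetectsProjectives I F) {X Z : T} (r : X ⟶ Z) :
    ∃ (Q : T) (w : Q ⟶ X), w ≫ r = 0 ∧ I.IsProjectiveObj Q ∧
      (∀ ⦃A : 𝔄⦄ (x : A ⟶ F.obj X), x ≫ F.map r = 0 →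
        ∃ (A' : 𝔄) (π : A' ⟶ A) (_ : Epi π) (y : A' ⟶ F.obj Q), π ≫ x = y ≫ F.map w) ∧
      ∀ ⦃P : T⦄, I.IsProjectiveObj P → ∀ s : P ⟶ X, s ≫ r = 0 → ∃ s' : P ⟶ Q, s = s' ≫ w := by
  obtain ⟨W, i, d, hT⟩ := distinguished_cocone_triangle₁ r
  obtain ⟨Q, q, hQ, hq⟩ := hF.enough W
  have := hF.epi_map hq
  have hir : i ≫ r = 0 := comp_distTriang_mor_zero₁₂ _ hT
  refine ⟨Q, q ≫ i, by simp [hir], hQ, ?_, ?_⟩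
  · intro A x hx
    obtain ⟨A', π, _, y, hy⟩ := exact_up_to_refinements_of_distTriang F hT x hx
    obtain ⟨A'', π', _, z, hz⟩ := surjective_up_to_refinements_of_epi (F.map q) y
    exact ⟨A'', π' ≫ π, epi_comp _ _, z, by
      rw [Category.assoc, hy, reassoc_of% hz, F.map_comp]⟩
  · intro P hP s hs
    obtain ⟨s₁, rfl⟩ := exists_lift_of_distTriang hT s hs
    obtain ⟨s₂, rfl⟩ := hq.exists_lift hP s₁
    exact ⟨s₂, by simp⟩

end DetectsProjectives

/-- A presentation of an object `A` as the image of `F(t)` for a morphism `t : P ⟶ Y` with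
`I`-projective source `P`, such that the given sets `S Q` consist, for `I`-projective `Q`, of the
morphisms `F(Q) ⟶ A` that lift to a morphism `Q ⟶ P` of `T`. -/
structure ImagePresentation (I : MorphismIdeal T) (F : T ⥤ 𝔄) (A : 𝔄)
    (S : ∀ P : T, Set (F.obj P ⟶ A)) where
  P : T
  Y : T
  t : P ⟶ Y
  p : F.obj P ⟶ A
  j : A ⟶ F.obj Y
  projective : I.IsProjectiveObj P
  epi : Epi p
  mono : Mono j
  fac : p ≫ j = F.map t
  mem_iff : ∀ ⦃Q : T⦄, I.IsProjectiveObj Q → ∀ g : F.obj Q ⟶ A,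
    g ∈ S Q ↔ ∃ s : Q ⟶ P, g = F.map s ≫ p

attribute [simp] ImagePresentation.fac
attribute [instance] ImagePresentation.epi ImagePresentation.mono

/-- The objects of `𝔄` with distinguished sets `adm P` of "liftable" morphisms from the objects
`F(P)` that come from a presentation as the image of a morphism in `T`. The presentation is not part
of the data. Only the sets `adm P` for `I`-projective `P` matter: the others are neither constrained
here nor respected by morphisms. -/
structure Presented (I : MorphismIdeal T) (F : T ⥤ 𝔄) : Type (max u v u' v') where
  obj : 𝔄
  adm (P : T) : Set (F.obj P ⟶ obj)
  nonempty_pres : Nonempty (ImagePresentation I F obj adm)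

namespace Presented

variable {I : MorphismIdeal T} {F : T ⥤ 𝔄} [F.IsHomological]

/-- A chosen presentation. -/
def pres (X : Presented I F) : ImagePresentation I F X.obj X.adm := X.nonempty_pres.some

lemma p_mem (X : Presented I F) : X.pres.p ∈ X.adm X.pres.P :=
  (X.pres.mem_iff X.pres.projective _).2 ⟨𝟙 _, by simp⟩

lemma precomp_mem (X : Presented I F) {P Q : T} (hP : I.IsProjectiveObj P)
    (hQ : I.IsProjectiveObj Q) (r : P ⟶ Q) {g : F.obj Q ⟶ X.obj} (hg : g ∈ X.adm Q) :
    F.map r ≫ g ∈ X.adm P := by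
  obtain ⟨s, rfl⟩ := (X.pres.mem_iff hQ _).1 hg
  exact (X.pres.mem_iff hP _).2 ⟨r ≫ s, by simp⟩

lemma zero_mem (X : Presented I F) {P : T} (hP : I.IsProjectiveObj P) :
    (0 : F.obj P ⟶ X.obj) ∈ X.adm P :=
  (X.pres.mem_iff hP _).2 ⟨0, by simp⟩

lemma add_mem (X : Presented I F) {P : T} (hP : I.IsProjectiveObj P) {g h : F.obj P ⟶ X.obj}
    (hg : g ∈ X.adm P) (hh : h ∈ X.adm P) : g + h ∈ X.adm P := by
  obtain ⟨s, rfl⟩ := (X.pres.mem_iff hP _).1 hg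
  obtain ⟨s', rfl⟩ := (X.pres.mem_iff hP _).1 hh
  exact (X.pres.mem_iff hP _).2 ⟨s + s', by simp [F.map_add]⟩

lemma neg_mem (X : Presented I F) {P : T} (hP : I.IsProjectiveObj P) {g : F.obj P ⟶ X.obj}
    (hg : g ∈ X.adm P) : -g ∈ X.adm P := by
  obtain ⟨s, rfl⟩ := (X.pres.mem_iff hP _).1 hg
  exact (X.pres.mem_iff hP _).2 ⟨-s, by simp [F.map_neg]⟩

/-- The morphisms in `𝔄` that preserve the liftable morphisms. -/
def homSubgroup (X Y : Presented I F) : AddSubgroup (X.obj ⟶ Y.obj) where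
  carrier := {f | ∀ ⦃P : T⦄, I.IsProjectiveObj P → ∀ g ∈ X.adm P, g ≫ f ∈ Y.adm P}
  zero_mem' P hP g hg := by simpa using Y.zero_mem hP
  add_mem' {f f'} hf hf' P hP g hg := by
    simpa using Y.add_mem hP (hf hP g hg) (hf' hP g hg)
  neg_mem' {f} hf P hP g hg := by simpa using Y.neg_mem hP (hf hP g hg)

/-- The morphism sets are lifted to the universe of the objects, so that the universal property of
`F` applies to functors into this category. -/
instance : Category.{max u v u' v'} (Presented I F) where
  Hom X Y := ULift.{max u v u' v'} (homSubgroup X Y)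
  id X := ⟨⟨𝟙 _, fun P _ g hg => by simpa using hg⟩⟩
  comp f g := ⟨⟨f.down.1 ≫ g.down.1, fun P hP h hh => by
    simpa using g.down.2 hP _ (f.down.2 hP _ hh)⟩⟩

/-- The underlying morphism in `𝔄`. -/
def hom {X Y : Presented I F} (f : X ⟶ Y) : X.obj ⟶ Y.obj := f.down.1

@[simp] lemma hom_comp {X Y Z : Presented I F} (f : X ⟶ Y) (g : Y ⟶ Z) :
    hom (f ≫ g) = hom f ≫ hom g := rfl

lemma hom_ext {X Y : Presented I F} {f g : X ⟶ Y} (h : hom f = hom g) : f = g :=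
  ULift.ext _ _ (Subtype.ext h)

instance : Preadditive (Presented I F) where
  homGroup X Y := inferInstanceAs (AddCommGroup (ULift (homSubgroup X Y)))
  add_comp _ _ _ f g h := ULift.ext _ _
    (Subtype.ext (Preadditive.add_comp _ _ _ f.down.1 g.down.1 h.down.1))
  comp_add _ _ _ f g h := ULift.ext _ _
    (Subtype.ext (Preadditive.comp_add _ _ _ f.down.1 g.down.1 h.down.1))

@[simp] lemma hom_zero (X Y : Presented I F) : hom (0 : X ⟶ Y) = 0 := rfl

/-- The functor forgetting the liftable morphisms. -/
def forget (I : MorphismIdeal T) (F : T ⥤ 𝔄) [F.IsHomological] : Presented I F ⥤ 𝔄 where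
  obj X := X.obj
  map f := hom f

instance : (forget I F).Additive where
  map_add := rfl

instance : (forget I F).Faithful where
  map_injective h := hom_ext h

lemma hom_mem {X Y : Presented I F} (f : X ⟶ Y) {P : T} (hP : I.IsProjectiveObj P)
    {g : F.obj P ⟶ X.obj} (hg : g ∈ X.adm P) : g ≫ hom f ∈ Y.adm P :=
  f.down.2 hP g hg

/-- Constructor for morphisms. -/
def homMk {X Y : Presented I F} (f : X.obj ⟶ Y.obj)
    (hf : ∀ ⦃P : T⦄, I.IsProjectiveObj P → ∀ g ∈ X.adm P, g ≫ f ∈ Y.adm P) : X ⟶ Y :=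
  ⟨⟨f, hf⟩⟩

lemma exists_lift {X Y : Presented I F} (f : X ⟶ Y) :
    ∃ s : X.pres.P ⟶ Y.pres.P, X.pres.p ≫ hom f = F.map s ≫ Y.pres.p :=
  (Y.pres.mem_iff X.pres.projective _).1 (hom_mem f X.pres.projective X.p_mem)

/-- The kernel of `f` is presented by a weak kernel `Q` in `T` of the morphism that induces `f`,
with the liftable morphisms of the source of `f` that factor through the kernel. -/
lemma exists_kernel_presentation (hF : DetectsProjectives I F) {X Y : Presented I F} (f : X ⟶ Y) :
    Nonempty (ImagePresentation I F (kernel (hom f))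
      (fun P => {g | g ≫ kernel.ι (hom f) ∈ X.adm P})) := by
  obtain ⟨s, hs⟩ := exists_lift f
  obtain ⟨Q, w, hw, hQ, hex, hlift⟩ := hF.exists_weakKernel (s ≫ Y.pres.t)
  have hfj : X.pres.p ≫ hom f ≫ Y.pres.j = F.map (s ≫ Y.pres.t) := by
    rw [reassoc_of% hs]; simp
  have h0 : (F.map w ≫ X.pres.p) ≫ hom f = 0 := by
    rw [← cancel_mono Y.pres.j, zero_comp, Category.assoc, Category.assoc, hfj, ← F.map_comp, hw,
      F.map_zero]
  refine ⟨⟨Q, X.pres.Y, w ≫ X.pres.t, kernel.lift _ _ h0, kernel.ι _ ≫ X.pres.j, hQ, ?_,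
    mono_comp _ _, by simp, ?_⟩⟩
  · rw [epi_iff_surjective_up_to_refinements]
    intro A x
    obtain ⟨A', π, _, y, hy⟩ := surjective_up_to_refinements_of_epi X.pres.p (x ≫ kernel.ι _)
    have hy0 : y ≫ F.map (s ≫ Y.pres.t) = 0 := by
      rw [← hfj, ← reassoc_of% hy]; simp
    obtain ⟨A'', π', _, z, hz⟩ := hex y hy0
    refine ⟨A'', π' ≫ π, epi_comp _ _, z, ?_⟩
    rw [← cancel_mono (kernel.ι _)]
    simp [hy, reassoc_of% hz]
  · intro P hP g
    constructor
    · intro hg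
      obtain ⟨r, hr⟩ := (X.pres.mem_iff hP _).1 hg
      have : r ≫ s ≫ Y.pres.t = 0 := by
        apply hF.eq_zero hP
        rw [F.map_comp, ← hfj, ← reassoc_of% hr]; simp
      obtain ⟨r', rfl⟩ := hlift hP r this
      refine ⟨r', ?_⟩
      rw [← cancel_mono (kernel.ι _)]
      simpa using hr
    · rintro ⟨s, rfl⟩
      exact (X.pres.mem_iff hP _).2 ⟨s ≫ w, by simp⟩

/-- The kernel of a morphism. -/
def ker (hF : DetectsProjectives I F) {X Y : Presented I F} (f : X ⟶ Y) : Presented I F :=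
  ⟨_, _, exists_kernel_presentation hF f⟩

/-- The inclusion of the kernel. -/
def kerι (hF : DetectsProjectives I F) {X Y : Presented I F} (f : X ⟶ Y) : ker hF f ⟶ X :=
  homMk (kernel.ι _) fun _ _ _ hg => hg

lemma kerι_comp (hF : DetectsProjectives I F) {X Y : Presented I F} (f : X ⟶ Y) :
    kerι hF f ≫ f = 0 :=
  hom_ext (by
    rw [hom_comp, hom_zero]; exact kernel.condition _)

/-- The universal property of the kernel. -/
def kerIsLimit (hF : DetectsProjectives I F) {X Y : Presented I F} (f : X ⟶ Y) :
    IsLimit (KernelFork.ofι (kerι hF f) (kerι_comp hF f)) :=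
  KernelFork.IsLimit.ofι _ _
    (fun {W'} g hg => homMk (kernel.lift _ (hom g) (by
        rw [← hom_comp, hg, hom_zero])) (fun P hP h hh => by
          have := hom_mem g hP hh
          rw [← kernel.lift_ι (hom f) (hom g) (by rw [← hom_comp, hg, hom_zero]),
            ← Category.assoc] at this
          exact this))
    (fun g hg => hom_ext (by
      rw [hom_comp]; exact kernel.lift_ι _ _ _))
    (fun g hg m hm => hom_ext (by
      apply (cancel_mono (kernel.ι (hom f))).1
      refine Eq.trans ?_ (kernel.lift_ι _ _ _).symm
      rw [← hm, hom_comp]; rfl))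

/-- The cokernel of `f : X ⟶ Y` embeds into `F(Z)`, where `Z` is the cone of the morphism to the
projective cover `P` of `Y` that combines a weak kernel of the presentation of `Y` with a lift `s`
of `f`. A morphism to `P` that dies in `Z` is liftable along `f`. -/
lemma exists_cokernel_data (hF : DetectsProjectives I F) {X Y : Presented I F} (f : X ⟶ Y) :
    ∃ (Z : T) (t : Y.pres.P ⟶ Z) (j : cokernel (hom f) ⟶ F.obj Z), Mono j ∧
      Y.pres.p ≫ cokernel.π (hom f) ≫ j = F.map t ∧
      ∀ ⦃P : T⦄, I.IsProjectiveObj P → ∀ r : P ⟶ Y.pres.P, r ≫ t = 0 →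
        ∃ r' : P ⟶ X.pres.P, F.map r ≫ Y.pres.p = F.map r' ≫ X.pres.p ≫ hom f := by
  obtain ⟨s, hs⟩ := exists_lift f
  obtain ⟨Q, w, hw, hQ, hex, hlift⟩ := hF.exists_weakKernel Y.pres.t
  have hwp : F.map w ≫ Y.pres.p = 0 := by
    rw [← cancel_mono Y.pres.j, Category.assoc, Y.pres.fac, ← F.map_comp, hw, F.map_zero, zero_comp]
  let d : Q ⊞ X.pres.P ⟶ Y.pres.P := biprod.desc w s
  obtain ⟨Z, t, e, hT⟩ := distinguished_cocone_triangle d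
  have hdt : d ≫ t = 0 := comp_distTriang_mor_zero₁₂ _ hT
  have hwt : w ≫ t = 0 := by
    have := (biprod.inl : Q ⟶ Q ⊞ X.pres.P) ≫= hdt
    simpa [d] using this
  have hst : s ≫ t = 0 := by
    have := (biprod.inr : X.pres.P ⟶ Q ⊞ X.pres.P) ≫= hdt
    simpa [d] using this
  have hd : d = biprod.fst ≫ w + biprod.snd ≫ s := by
    ext <;> simp [d]
  -- `t` vanishes on the weak kernel `w`, hence `F(t)` factors through the image `Y.obj` of the
  -- presentation of `Y`.
  obtain ⟨j₀, hj₀⟩ : ∃ j₀ : Y.obj ⟶ F.obj Z, Y.pres.p ≫ j₀ = F.map t :=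
    exists_desc_of_exact_up_to_refinements (F.map w) _ hwp
      (fun A x hx => hex x (by rw [← Y.pres.fac, reassoc_of% hx, zero_comp])) _
      (by rw [← F.map_comp, hwt, F.map_zero])
  have hfj : hom f ≫ j₀ = 0 := by
    rw [← cancel_epi X.pres.p, reassoc_of% hs, hj₀, ← F.map_comp, hst, F.map_zero, comp_zero]
  refine ⟨Z, t, cokernel.desc _ j₀ hfj, ?_, by simpa using hj₀, ?_⟩
  · refine Preadditive.mono_of_cancel_zero _ fun {A} x hx => ?_
    obtain ⟨A', π, _, y, hy⟩ := surjective_up_to_refinements_of_epi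
      (Y.pres.p ≫ cokernel.π (hom f)) x
    have hyt : y ≫ F.map t = 0 := by
      have := hy =≫ cokernel.desc _ j₀ hfj
      simpa [hx, hj₀] using this.symm
    obtain ⟨A'', π', _, z, hz⟩ := exact_up_to_refinements_of_distTriang F hT y hyt
    rw [← cancel_epi π, ← cancel_epi π', hy, reassoc_of% hz, hd, F.map_add, F.map_comp, F.map_comp]
    simp only [Preadditive.add_comp, Preadditive.comp_add, Category.assoc, reassoc_of% hwp,
      ← reassoc_of% hs]
    simp
  · intro P hP r hr
    obtain ⟨r', rfl⟩ := exists_lift_of_distTriang hT r hr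
    refine ⟨r' ≫ biprod.snd, ?_⟩
    rw [hd]
    simp [F.map_add, hwp, hs]

lemma exists_cokernel_presentation (hF : DetectsProjectives I F) {X Y : Presented I F} (f : X ⟶ Y) :
    Nonempty (ImagePresentation I F (cokernel (hom f))
      (fun P => {g | ∃ g' ∈ Y.adm P, g = g' ≫ cokernel.π (hom f)})) := by
  obtain ⟨Z, t, j, _, hj, -⟩ := exists_cokernel_data hF f
  refine ⟨⟨Y.pres.P, Z, t, Y.pres.p ≫ cokernel.π _, j, Y.pres.projective, epi_comp _ _,
    inferInstance, by simpa using hj, ?_⟩⟩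
  intro P hP g
  constructor
  · rintro ⟨g', hg', rfl⟩
    obtain ⟨s, rfl⟩ := (Y.pres.mem_iff hP _).1 hg'
    exact ⟨s, by simp⟩
  · rintro ⟨s, rfl⟩
    exact ⟨F.map s ≫ Y.pres.p, (Y.pres.mem_iff hP _).2 ⟨s, rfl⟩, by simp⟩

/-- Liftable morphisms that vanish in the cokernel of `f` lift along `f`. -/
lemma exists_mem_of_comp_cokernel (hF : DetectsProjectives I F) {X Y : Presented I F} (f : X ⟶ Y)
    {P : T} (hP : I.IsProjectiveObj P) {h : F.obj P ⟶ Y.obj} (hh : h ∈ Y.adm P)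
    (h0 : h ≫ cokernel.π (hom f) = 0) :
    ∃ h' ∈ X.adm P, h = h' ≫ hom f := by
  obtain ⟨Z, t, j, _, hj, hlift⟩ := exists_cokernel_data hF f
  obtain ⟨r, rfl⟩ := (Y.pres.mem_iff hP _).1 hh
  have hrt : r ≫ t = 0 := hF.eq_zero hP _ (by
    rw [F.map_comp, ← hj]
    have := h0 =≫ j
    simpa using this)
  obtain ⟨r', hr'⟩ := hlift hP r hrt
  exact ⟨F.map r' ≫ X.pres.p, (X.pres.mem_iff hP _).2 ⟨r', rfl⟩, by simpa using hr'⟩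

/-- The cokernel of a morphism. -/
def coker (hF : DetectsProjectives I F) {X Y : Presented I F} (f : X ⟶ Y) : Presented I F :=
  ⟨_, _, exists_cokernel_presentation hF f⟩

/-- The projection onto the cokernel. -/
def cokerπ (hF : DetectsProjectives I F) {X Y : Presented I F} (f : X ⟶ Y) : Y ⟶ coker hF f :=
  homMk (cokernel.π _) fun _ _ g hg => ⟨g, hg, rfl⟩

lemma comp_cokerπ (hF : DetectsProjectives I F) {X Y : Presented I F} (f : X ⟶ Y) :
    f ≫ cokerπ hF f = 0 :=
  hom_ext (by
    rw [hom_comp, hom_zero]; exact cokernel.condition _)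

/-- The universal property of the cokernel. -/
def cokerIsColimit (hF : DetectsProjectives I F) {X Y : Presented I F} (f : X ⟶ Y) :
    IsColimit (CokernelCofork.ofπ (cokerπ hF f) (comp_cokerπ hF f)) :=
  CokernelCofork.IsColimit.ofπ _ _
    (fun {W'} g hg => homMk (cokernel.desc _ (hom g) (by
        rw [← hom_comp, hg, hom_zero])) (fun P hP h hh => by
          obtain ⟨h', hh', rfl⟩ := hh
          have := hom_mem g hP hh'
          rw [← cokernel.π_desc (hom f) (hom g) (by rw [← hom_comp, hg, hom_zero]),
            ← Category.assoc] at this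
          exact this))
    (fun g hg => hom_ext (by
      rw [hom_comp]; exact cokernel.π_desc _ _ _))
    (fun g hg m hm => hom_ext (by
      apply (cancel_epi (cokernel.π (hom f))).1
      refine Eq.trans ?_ (cokernel.π_desc _ _ _).symm
      rw [← hm, hom_comp]; rfl))

lemma exists_biprod_presentation (X Y : Presented I F) :
    Nonempty (ImagePresentation I F (X.obj ⊞ Y.obj)
      (fun P => {g | g ≫ biprod.fst ∈ X.adm P ∧ g ≫ biprod.snd ∈ Y.adm P})) := by
  have := preservesBinaryBiproducts_of_preservesBiproducts F
  let e := F.mapBiprod X.pres.P Y.pres.P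
  let e' := F.mapBiprod X.pres.Y Y.pres.Y
  have h₁ : e.hom ≫ biprod.fst = F.map biprod.fst := biprod.lift_fst _ _
  have h₂ : e.hom ≫ biprod.snd = F.map biprod.snd := biprod.lift_snd _ _
  have h₁' : e'.hom ≫ biprod.fst = F.map biprod.fst := biprod.lift_fst _ _
  have h₂' : e'.hom ≫ biprod.snd = F.map biprod.snd := biprod.lift_snd _ _
  refine ⟨⟨X.pres.P ⊞ Y.pres.P, X.pres.Y ⊞ Y.pres.Y, biprod.map X.pres.t Y.pres.t,
    e.hom ≫ biprod.map X.pres.p Y.pres.p, biprod.map X.pres.j Y.pres.j ≫ e'.inv,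
    X.pres.projective.biprod Y.pres.projective, epi_comp _ _, mono_comp _ _, ?_, ?_⟩⟩
  · rw [← cancel_mono e'.hom]
    apply biprod.hom_ext
    · simp only [Category.assoc, Iso.inv_hom_id, Category.comp_id, biprod.map_fst, h₁',
        biprod.map_fst_assoc, reassoc_of% h₁, ImagePresentation.fac]
      rw [← F.map_comp, ← F.map_comp, biprod.map_fst]
    · simp only [Category.assoc, Iso.inv_hom_id, Category.comp_id, biprod.map_snd, h₂',
        biprod.map_snd_assoc, reassoc_of% h₂, ImagePresentation.fac]
      rw [← F.map_comp, ← F.map_comp, biprod.map_snd]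
  · intro P hP g
    constructor
    · rintro ⟨h, h'⟩
      obtain ⟨s, hs⟩ := (X.pres.mem_iff hP _).1 h
      obtain ⟨s', hs'⟩ := (Y.pres.mem_iff hP _).1 h'
      refine ⟨biprod.lift s s', ?_⟩
      apply biprod.hom_ext
      · simp [hs, reassoc_of% h₁, ← F.map_comp_assoc]
      · simp [hs', reassoc_of% h₂, ← F.map_comp_assoc]
    · rintro ⟨s, rfl⟩
      exact ⟨(X.pres.mem_iff hP _).2 ⟨s ≫ biprod.fst, by simp [reassoc_of% h₁]⟩,
        (Y.pres.mem_iff hP _).2 ⟨s ≫ biprod.snd, by simp [reassoc_of% h₂]⟩⟩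

/-- The product of two objects. -/
def prod (X Y : Presented I F) : Presented I F := ⟨_, _, exists_biprod_presentation X Y⟩

/-- The product of two objects is a binary product. -/
def prodIsLimit (X Y : Presented I F) :
    IsLimit (BinaryFan.mk (P := prod X Y) (homMk (Y := X) biprod.fst fun _ _ _ hg => hg.1)
      (homMk (Y := Y) biprod.snd fun _ _ _ hg => hg.2)) :=
  BinaryFan.IsLimit.mk _
    (fun {W} f g => homMk (biprod.lift (hom f) (hom g)) fun P hP h hh => by
      have h₁ := hom_mem f hP hh
      have h₂ := hom_mem g hP hh
      rw [← biprod.lift_fst (hom f) (hom g), ← Category.assoc] at h₁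
      rw [← biprod.lift_snd (hom f) (hom g), ← Category.assoc] at h₂
      exact ⟨h₁, h₂⟩)
    (fun f g => hom_ext (biprod.lift_fst _ _))
    (fun f g => hom_ext (biprod.lift_snd _ _))
    (fun f g m h₁ h₂ => hom_ext (by
      have h₁' : hom m ≫ biprod.fst = hom f := congrArg hom h₁
      have h₂' : hom m ≫ biprod.snd = hom g := congrArg hom h₂
      exact biprod.hom_ext _ _ (h₁'.trans (biprod.lift_fst _ _).symm)
        (h₂'.trans (biprod.lift_snd _ _).symm)))

open ZeroObject in
lemma exists_zero_presentation :
    Nonempty (ImagePresentation I F (0 : 𝔄) (fun _ => Set.univ)) :=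
  ⟨⟨0, 0, 0, 0, 0, fun _ _ g _ _ => by rw [(isZero_zero T).eq_of_src g 0, zero_comp],
    ⟨fun _ _ _ => (isZero_zero 𝔄).eq_of_src _ _⟩, ⟨fun _ _ _ => (isZero_zero 𝔄).eq_of_tgt _ _⟩,
    by simp, fun _ _ g => ⟨fun _ => ⟨0, (isZero_zero 𝔄).eq_of_tgt _ _⟩, fun _ => trivial⟩⟩⟩

instance : HasTerminal (Presented I F) := by
  let Z : Presented I F := ⟨_, _, exists_zero_presentation⟩
  have h : IsTerminal Z := IsTerminal.ofUniqueHom (fun _ => 0)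
    (fun _ _ => hom_ext ((isZero_zero 𝔄).eq_of_tgt _ _))
  exact h.hasTerminal

instance : HasBinaryProducts (Presented I F) :=
  have (X Y : Presented I F) : HasLimit (pair X Y) := ⟨⟨_, prodIsLimit X Y⟩⟩
  hasBinaryProducts_of_hasLimit_pair _

instance : HasFiniteProducts (Presented I F) := hasFiniteProducts_of_has_binary_and_terminal

lemma mono_hom (hF : DetectsProjectives I F) {X Y : Presented I F} (f : X ⟶ Y) [Mono f] :
    Mono (hom f) := by
  have h : kerι hF f = 0 := by rw [← cancel_mono f, kerι_comp, zero_comp]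
  exact Preadditive.mono_of_kernel_zero (congrArg hom h)

lemma epi_hom (hF : DetectsProjectives I F) {X Y : Presented I F} (f : X ⟶ Y) [Epi f] :
    Epi (hom f) := by
  have h : cokerπ hF f = 0 := by rw [← cancel_epi f, comp_cokerπ, comp_zero]
  exact Preadditive.epi_of_cokernel_zero (congrArg hom h)

/-- Liftable morphisms lift along epimorphisms. -/
lemma exists_mem_of_epi (hF : DetectsProjectives I F) {X Y : Presented I F} (f : X ⟶ Y) [Epi f]
    {P : T} (hP : I.IsProjectiveObj P) {h : F.obj P ⟶ Y.obj} (hh : h ∈ Y.adm P) :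
    ∃ h' ∈ X.adm P, h = h' ≫ hom f := by
  have := epi_hom hF f
  exact exists_mem_of_comp_cokernel hF f hP hh (by rw [cokernel.π_of_epi, comp_zero])

/-- Monomorphisms are kernels. -/
def monoIsLimit (hF : DetectsProjectives I F) {X Y : Presented I F} (f : X ⟶ Y) [Mono f] :
    IsLimit (KernelFork.ofι f (comp_cokerπ hF f)) :=
  have := mono_hom hF f
  KernelFork.IsLimit.ofι' _ _ (fun {W} g hg => by
    have hg' : hom g ≫ cokernel.π (hom f) = 0 := congrArg hom hg
    refine ⟨homMk (Abelian.monoLift (hom f) (hom g) hg') fun P hP h hh => ?_, hom_ext ?_⟩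
    · obtain ⟨h', hh', e⟩ := exists_mem_of_comp_cokernel hF f hP (hom_mem g hP hh) (by
        rw [Category.assoc, hg', comp_zero])
      have : h ≫ Abelian.monoLift (hom f) (hom g) hg' = h' := by
        rw [← cancel_mono (hom f), ← e, Category.assoc, Abelian.monoLift_comp]
      exact this ▸ hh'
    · exact Abelian.monoLift_comp _ _ _)

/-- Epimorphisms are cokernels. -/
def epiIsColimit (hF : DetectsProjectives I F) {X Y : Presented I F} (f : X ⟶ Y) [Epi f] :
    IsColimit (CokernelCofork.ofπ f (kerι_comp hF f)) :=
  have := epi_hom hF f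
  CokernelCofork.IsColimit.ofπ' _ _ (fun {W} g hg => by
    have hg' : kernel.ι (hom f) ≫ hom g = 0 := congrArg hom hg
    refine ⟨homMk (Abelian.epiDesc (hom f) (hom g) hg') fun P hP h hh => ?_, hom_ext ?_⟩
    · obtain ⟨h', hh', rfl⟩ := exists_mem_of_epi hF f hP hh
      rw [Category.assoc, Abelian.comp_epiDesc]
      exact hom_mem g hP hh'
    · exact Abelian.comp_epiDesc (hom f) (hom g) hg')

/-- The category of presented objects is abelian. -/
@[reducible]
def abelian (hF : DetectsProjectives I F) : Abelian (Presented I F) where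
  has_kernels := ⟨fun f => ⟨⟨_, kerIsLimit hF f⟩⟩⟩
  has_cokernels := ⟨fun f => ⟨⟨_, cokerIsColimit hF f⟩⟩⟩
  normalMonoOfMono f _ := ⟨⟨_, _, _, monoIsLimit hF f⟩⟩
  normalEpiOfEpi f _ := ⟨⟨_, _, _, epiIsColimit hF f⟩⟩

lemma preservesFiniteLimits_forget (hF : DetectsProjectives I F) :
    PreservesFiniteLimits (forget I F) := by
  let _ := abelian hF
  have (X Y : Presented I F) (f : X ⟶ Y) : PreservesLimit (parallelPair f 0) (forget I F) :=
    preservesLimit_of_preserves_limit_cone (kerIsLimit hF f)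
      ((KernelFork.isLimitMapConeEquiv _ _).symm (kernelIsKernel (hom f)))
  exact Functor.preservesFiniteLimits_of_preservesKernels _

lemma preservesFiniteColimits_forget (hF : DetectsProjectives I F) :
    PreservesFiniteColimits (forget I F) := by
  let _ := abelian hF
  have (X Y : Presented I F) (f : X ⟶ Y) : PreservesColimit (parallelPair f 0) (forget I F) :=
    preservesColimit_of_preserves_colimit_cocone (cokerIsColimit hF f)
      ((CokernelCofork.isColimitMapCoconeEquiv _ _).symm (cokernelIsCokernel (hom f)))
  exact Functor.preservesFiniteColimits_of_preservesCokernels _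

end Presented

end Presented

/-! ### The shift on presented objects -/

section PresentedShift

variable {T : Type u} [Category.{v} T] [Preadditive T] [HasZeroObject T] [HasShift T ℤ]
  [∀ n : ℤ, (shiftFunctor T n).Additive] [Pretriangulated T]
  {𝔄 : Type u'} [Category.{v'} 𝔄] [Abelian 𝔄] [HasShift 𝔄 ℤ]

namespace Presented

variable {I : MorphismIdeal T} {F : T ⥤ 𝔄} [F.IsHomological] [F.CommShift ℤ]

/-- The liftable morphisms into a shifted object: those that factor through the shift of a liftable
morphism `h : F(Q) ⟶ X` along a morphism `P ⟶ Q⟦n⟧` of `T`. -/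
def shiftAdm (X : Presented I F) (n : ℤ) (P : T) : Set (F.obj P ⟶ X.obj⟦n⟧) :=
  {g | ∃ (Q : T) (_ : I.IsProjectiveObj Q) (h : F.obj Q ⟶ X.obj) (_ : h ∈ X.adm Q) (r : P ⟶ Q⟦n⟧),
    g = F.map r ≫ (F.commShiftIso n).hom.app Q ≫ h⟦n⟧'}

lemma exists_shift_presentation (hF : DetectsProjectives I F) (X : Presented I F) (n : ℤ) :
    Nonempty (ImagePresentation I F (X.obj⟦n⟧) (X.shiftAdm n)) := by
  refine ⟨⟨X.pres.P⟦n⟧, X.pres.Y⟦n⟧, X.pres.t⟦n⟧', (F.commShiftIso n).hom.app _ ≫ X.pres.p⟦n⟧',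
    X.pres.j⟦n⟧' ≫ (F.commShiftIso n).inv.app _, hF.shift X.pres.projective n,
    epi_comp _ _, mono_comp _ _, ?_, ?_⟩⟩
  · rw [Category.assoc, ← Functor.map_comp_assoc, X.pres.fac, Functor.commShiftIso_inv_naturality,
      Iso.hom_inv_id_app_assoc]
  · intro P hP g
    constructor
    · rintro ⟨Q, hQ, h, hh, r, rfl⟩
      obtain ⟨s, rfl⟩ := (X.pres.mem_iff hQ _).1 hh
      exact ⟨r ≫ s⟦n⟧', by simp⟩
    · rintro ⟨s, rfl⟩
      exact ⟨_, X.pres.projective, _, X.p_mem, s, rfl⟩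

/-- The shift of a presented object. -/
def shiftObj (hF : DetectsProjectives I F) (n : ℤ) (X : Presented I F) : Presented I F :=
  ⟨X.obj⟦n⟧, X.shiftAdm n, exists_shift_presentation hF X n⟩

lemma comp_map_mem_shiftAdm {X Y : Presented I F} (f : X ⟶ Y) (n : ℤ) {P : T}
    {g : F.obj P ⟶ X.obj⟦n⟧} (hg : g ∈ X.shiftAdm n P) :
    g ≫ (hom f)⟦n⟧' ∈ Y.shiftAdm n P := by
  obtain ⟨Q, hQ, h, hh, r, rfl⟩ := hg
  exact ⟨Q, hQ, h ≫ hom f, hom_mem f hQ hh, r, by simp⟩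

lemma comp_shiftFunctorZero_mem (X : Presented I F) {P : T} (hP : I.IsProjectiveObj P)
    {g : F.obj P ⟶ X.obj⟦(0 : ℤ)⟧} (hg : g ∈ X.shiftAdm 0 P) :
    g ≫ (shiftFunctorZero 𝔄 ℤ).hom.app X.obj ∈ X.adm P := by
  obtain ⟨Q, hQ, h, hh, r, rfl⟩ := hg
  have := (shiftFunctorZero 𝔄 ℤ).hom.naturality h
  dsimp at this
  have e : (F.map r ≫ (F.commShiftIso (0 : ℤ)).hom.app Q ≫ h⟦(0 : ℤ)⟧') ≫
      (shiftFunctorZero 𝔄 ℤ).hom.app X.obj =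
        F.map (r ≫ (shiftFunctorZero T ℤ).hom.app Q) ≫ h := by
    simp [Functor.commShiftIso_zero, this]
  rw [e]
  exact X.precomp_mem hP hQ _ hh

lemma comp_shiftFunctorZero_inv_mem (X : Presented I F) {P : T} (hP : I.IsProjectiveObj P)
    {g : F.obj P ⟶ X.obj} (hg : g ∈ X.adm P) :
    g ≫ (shiftFunctorZero 𝔄 ℤ).inv.app X.obj ∈ X.shiftAdm 0 P := by
  refine ⟨P, hP, g, hg, (shiftFunctorZero T ℤ).inv.app P, ?_⟩
  have := (shiftFunctorZero 𝔄 ℤ).inv.naturality g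
  dsimp at this
  rw [this, Functor.commShiftIso_zero, Functor.CommShift.isoZero_hom_app, Category.assoc,
    ← F.map_comp_assoc, Iso.inv_hom_id_app]
  exact ((congrArg (· ≫ _) (F.map_id P)).trans (Category.id_comp _)).symm

lemma comp_shiftFunctorAdd_eq {X : Presented I F} (a b : ℤ) {P Q : T} (h : F.obj Q ⟶ X.obj)
    (r : P ⟶ Q⟦a + b⟧) :
    (F.map r ≫ (F.commShiftIso (a + b)).hom.app Q ≫ h⟦a + b⟧') ≫
        (shiftFunctorAdd 𝔄 a b).hom.app X.obj =
      F.map (r ≫ (shiftFunctorAdd T a b).hom.app Q) ≫ (F.commShiftIso b).hom.app (Q⟦a⟧) ≫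
        ((F.commShiftIso a).hom.app Q ≫ h⟦a⟧')⟦b⟧' := by
  have := (shiftFunctorAdd 𝔄 a b).hom.naturality h
  dsimp at this
  rw [Functor.commShiftIso_add, Functor.CommShift.isoAdd_hom_app]
  simp only [Category.assoc, this, Functor.map_comp]
  rw [Iso.inv_hom_id_app_assoc]

lemma comp_shiftFunctorAdd_inv_eq {X : Presented I F} (a b : ℤ) {P Q Q' : T} (h : F.obj Q' ⟶ X.obj)
    (r' : Q ⟶ Q'⟦a⟧) (r : P ⟶ Q⟦b⟧) :
    (F.map r ≫ (F.commShiftIso b).hom.app Q ≫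
      (F.map r' ≫ (F.commShiftIso a).hom.app Q' ≫ h⟦a⟧')⟦b⟧') ≫
        (shiftFunctorAdd 𝔄 a b).inv.app X.obj =
      F.map (r ≫ r'⟦b⟧' ≫ (shiftFunctorAdd T a b).inv.app Q') ≫
        (F.commShiftIso (a + b)).hom.app Q' ≫ h⟦a + b⟧' := by
  rw [← cancel_mono ((shiftFunctorAdd 𝔄 a b).hom.app X.obj), comp_shiftFunctorAdd_eq]
  have h₁ := (F.commShiftIso b).hom.naturality r'
  dsimp only [Functor.comp_map] at h₁
  have h₂ : (shiftFunctorAdd T a b).inv.app Q' ≫ (shiftFunctorAdd T a b).hom.app Q' =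
    𝟙 ((Q'⟦a⟧)⟦b⟧) := Iso.inv_hom_id_app _ _
  have h₃ : (shiftFunctorAdd 𝔄 a b).inv.app X.obj ≫ (shiftFunctorAdd 𝔄 a b).hom.app X.obj =
    𝟙 ((X.obj⟦a⟧)⟦b⟧) := Iso.inv_hom_id_app _ _
  simp only [Category.assoc, h₂, h₃, Functor.map_comp, reassoc_of% h₁, Category.comp_id]

/-- The shift functor on presented objects. -/
def shiftFun (hF : DetectsProjectives I F) (n : ℤ) : Presented I F ⥤ Presented I F where
  obj X := shiftObj hF n X
  map {X Y} f := homMk (X := shiftObj hF n X) (Y := shiftObj hF n Y) ((hom f)⟦n⟧')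
    (fun _ _ _ hg => comp_map_mem_shiftAdm f n hg)
  map_id _ := hom_ext ((shiftFunctor 𝔄 n).map_id _)
  map_comp _ _ := hom_ext ((shiftFunctor 𝔄 n).map_comp _ _)

/-- Constructor for isomorphisms. -/
def isoMk {X Y : Presented I F} (e : X.obj ≅ Y.obj)
    (h : ∀ ⦃P : T⦄, I.IsProjectiveObj P → ∀ g ∈ X.adm P, g ≫ e.hom ∈ Y.adm P)
    (h' : ∀ ⦃P : T⦄, I.IsProjectiveObj P → ∀ g ∈ Y.adm P, g ≫ e.inv ∈ X.adm P) : X ≅ Y where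
  hom := homMk e.hom h
  inv := homMk e.inv h'
  hom_inv_id := hom_ext e.hom_inv_id
  inv_hom_id := hom_ext e.inv_hom_id

lemma hom_eqToHom {X Y : Presented I F} (h : X = Y) :
    hom (eqToHom h) = eqToHom (congrArg Presented.obj h) := by
  subst h; rfl

/-- The isomorphism between the shift by zero and the identity. -/
def shiftZero (hF : DetectsProjectives I F) : shiftFun hF 0 ≅ 𝟭 (Presented I F) :=
  NatIso.ofComponents (fun X => isoMk (X := shiftObj hF 0 X) (Y := X)
    ((shiftFunctorZero 𝔄 ℤ).app X.obj) (fun _ hP _ hg => comp_shiftFunctorZero_mem X hP hg)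
    (fun _ hP _ hg => comp_shiftFunctorZero_inv_mem X hP hg))
    (fun f => hom_ext ((shiftFunctorZero 𝔄 ℤ).hom.naturality (hom f)))

/-- The isomorphism between the shift by a sum and the composition of the shifts. -/
def shiftAdd (hF : DetectsProjectives I F) (a b : ℤ) :
    shiftFun (I := I) (F := F) hF (a + b) ≅ shiftFun hF a ⋙ shiftFun hF b :=
  NatIso.ofComponents (fun X => isoMk (X := shiftObj hF (a + b) X)
    (Y := shiftObj hF b (shiftObj hF a X)) ((shiftFunctorAdd 𝔄 a b).app X.obj) (by
      rintro P hP _ ⟨Q, hQ, h, hh, r, rfl⟩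
      exact ⟨Q⟦a⟧, hF.shift hQ a, (F.commShiftIso a).hom.app Q ≫ h⟦a⟧',
        ⟨Q, hQ, h, hh, 𝟙 _, by rw [F.map_id]; exact (Category.id_comp _).symm⟩,
          r ≫ (shiftFunctorAdd T a b).hom.app Q,
        comp_shiftFunctorAdd_eq a b h r⟩) (by
      rintro P hP _ ⟨Q, hQ, _, ⟨Q', hQ', h, hh, r', rfl⟩, r, rfl⟩
      exact ⟨Q', hQ', h, hh, r ≫ r'⟦b⟧' ≫ (shiftFunctorAdd T a b).inv.app Q',
        comp_shiftFunctorAdd_inv_eq a b h r' r⟩))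
    (fun f => hom_ext ((shiftFunctorAdd 𝔄 a b).hom.naturality (hom f)))

/-- The shift on presented objects. -/
def shiftCore (hF : DetectsProjectives I F) : ShiftMkCore (Presented I F) ℤ where
  F := shiftFun hF
  zero := shiftZero hF
  add := shiftAdd hF
  assoc_hom_app a b c X := hom_ext (by
    have := shiftFunctorAdd'_assoc_hom_app a b c _ _ _ rfl rfl rfl X.obj
    rw [shiftFunctorAdd'_eq_shiftFunctorAdd, shiftFunctorAdd'_eq_shiftFunctorAdd,
      shiftFunctorAdd'_eq_shiftFunctorAdd, shiftFunctorAdd', Iso.trans_hom, eqToIso.hom,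
      NatTrans.comp_app, eqToHom_app, Category.assoc] at this
    rw [hom_comp, hom_comp, hom_comp, hom_eqToHom]
    exact this)
  zero_add_hom_app n X := hom_ext (by
    rw [hom_comp, hom_eqToHom]
    exact shiftFunctorAdd_zero_add_hom_app n X.obj)
  add_zero_hom_app n X := hom_ext (by
    rw [hom_comp, hom_eqToHom]
    exact shiftFunctorAdd_add_zero_hom_app n X.obj)

/-- The category of presented objects has a shift. -/
@[reducible]
def hasShift (hF : DetectsProjectives I F) : HasShift (Presented I F) ℤ :=
  hasShiftMk _ _ (shiftCore hF)

/-- The forgetful functor commutes with the shift. -/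
@[reducible]
def forgetCommShift (hF : DetectsProjectives I F) :
    let _ := hasShift hF
    (forget I F).CommShift ℤ :=
  let _ := hasShift hF
  let e (n : ℤ) : shiftFunctor (Presented I F) n ⋙ forget I F ≅ forget I F ⋙ shiftFunctor 𝔄 n :=
    (NatIso.ofComponents (fun X => Iso.refl (X.obj⟦n⟧))
      (fun _ => (Category.comp_id _).trans (Category.id_comp _).symm) :
        shiftFun hF n ⋙ forget I F ≅ forget I F ⋙ shiftFunctor 𝔄 n)
  { commShiftIso := e
    commShiftIso_zero := by
      ext X
      rw [Functor.CommShift.isoZero_hom_app]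
      exact ((shiftFunctorZero 𝔄 ℤ).hom_inv_id_app X.obj).symm
    commShiftIso_add a b := by
      ext X
      refine Eq.trans ?_ (Functor.CommShift.isoAdd_hom_app (e a) (e b) X).symm
      have := (shiftFunctorAdd 𝔄 a b).hom_inv_id_app X.obj
      refine this.symm.trans ?_
      refine congrArg ((shiftFunctorAdd 𝔄 a b).hom.app X.obj ≫ ·) ?_
      refine ((Category.id_comp _).trans ?_).symm
      refine (congrArg (· ≫ (shiftFunctorAdd 𝔄 a b).inv.app X.obj)
        ((shiftFunctor 𝔄 b).map_id (X.obj⟦a⟧))).trans (Category.id_comp _) }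

lemma exists_presentation_map (hF : DetectsProjectives I F) (X : T) :
    Nonempty (ImagePresentation I F (F.obj X) (fun P => Set.range (F.map (X := P) (Y := X)))) := by
  obtain ⟨P, t, hP, ht⟩ := hF.enough X
  refine ⟨⟨P, X, t, F.map t, 𝟙 _, hP, hF.epi_map ht, inferInstance, by simp, ?_⟩⟩
  intro Q hQ g
  constructor
  · rintro ⟨s, rfl⟩
    obtain ⟨s', rfl⟩ := ht.exists_lift hQ s
    exact ⟨s', by simp⟩
  · rintro ⟨s, rfl⟩
    exact ⟨s ≫ t, by simp⟩

/-- The lift of `F` to presented objects: the liftable morphisms to `F(X)` are those coming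
from `T`. -/
def lift (hF : DetectsProjectives I F) : T ⥤ Presented I F where
  obj X := ⟨F.obj X, _, exists_presentation_map hF X⟩
  map f := homMk (F.map f) (by
    rintro P hP _ ⟨s, rfl⟩
    exact ⟨s ≫ f, by simp⟩)
  map_id X := hom_ext (F.map_id X)
  map_comp f g := hom_ext (F.map_comp f g)

/-- A morphism `P ⟶ X⟦n⟧` is the shift of a morphism out of the `I`-projective object `P⟦-n⟧`. -/
lemma map_comp_commShiftIso_mem (hF : DetectsProjectives I F) (X : T) (n : ℤ) {P : T}
    (hP : I.IsProjectiveObj P) (s : P ⟶ X⟦n⟧) :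
    F.map s ≫ (F.commShiftIso n).hom.app X ∈ ((lift hF).obj X).shiftAdm n P := by
  let e := (shiftFunctorCompIsoId T (-n) n (by simp)).app P
  refine ⟨P⟦-n⟧, hF.shift hP _, F.map ((shiftFunctor T n).preimage (e.hom ≫ s)), ⟨_, rfl⟩,
    e.inv, ?_⟩
  have := (F.commShiftIso n).hom.naturality ((shiftFunctor T n).preimage (e.hom ≫ s))
  dsimp only [Functor.comp_map] at this
  refine Eq.trans ?_ (congrArg (F.map e.inv ≫ ·) this)
  rw [Functor.map_preimage]
  refine Eq.trans ?_ (F.map_comp_assoc _ _ _)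
  rw [Iso.inv_hom_id_assoc]
  rfl

/-- The lift of `F` to presented objects commutes with the shift. -/
@[reducible]
def liftCommShift (hF : DetectsProjectives I F) :
    let _ := hasShift hF
    (lift hF).CommShift ℤ :=
  let _ := hasShift hF
  { commShiftIso n := NatIso.ofComponents (fun X =>
      isoMk (X := (lift hF).obj (X⟦n⟧)) (Y := shiftObj hF n ((lift hF).obj X))
        ((F.commShiftIso n).app X) (by
          rintro P hP _ ⟨s, rfl⟩
          exact map_comp_commShiftIso_mem hF X n hP s) (by
          rintro P hP _ ⟨Q, hQ, _, ⟨s, rfl⟩, r, rfl⟩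
          refine ⟨r ≫ s⟦n⟧', ?_⟩
          have := (F.commShiftIso n).inv.naturality s
          dsimp only [Functor.comp_map] at this
          rw [F.map_comp]
          refine Eq.trans ?_ (Category.assoc (F.map r)
            ((F.commShiftIso n).hom.app Q ≫ (F.map s)⟦n⟧')
            ((F.commShiftIso n).inv.app X)).symm
          rw [Category.assoc, this, Iso.hom_inv_id_app_assoc]))
      (fun f => hom_ext ((F.commShiftIso n).hom.naturality f))
    commShiftIso_zero := by
      ext X
      apply hom_ext
      rw [Functor.CommShift.isoZero_hom_app]
      have := NatTrans.congr_app (congrArg Iso.hom (F.commShiftIso_zero ℤ)) X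
      rw [Functor.CommShift.isoZero_hom_app] at this
      exact this
    commShiftIso_add a b := by
      ext X
      apply hom_ext
      rw [Functor.CommShift.isoAdd_hom_app]
      have := NatTrans.congr_app (congrArg Iso.hom (F.commShiftIso_add a b)) X
      rw [Functor.CommShift.isoAdd_hom_app] at this
      exact this }

end Presented

end PresentedShift

/-! ### Consequences of universality -/

section Universality

section AsSmall

variable (C : Type u) [Category.{v} C] [HasShift C ℤ]

/-- The shift on `AsSmall C`. -/
@[reducible]
def asSmallHasShift : HasShift (AsSmall.{w} C) ℤ :=
  (AsSmall.equiv (C := C)).fullyFaithfulInverse.hasShift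
    (fun n => AsSmall.down ⋙ shiftFunctor C n ⋙ AsSmall.up) (fun _ => Iso.refl _)

/-- The embedding of `C` into `AsSmall C` commutes with the shift. -/
@[reducible]
def asSmallUpCommShift :
    let _ := asSmallHasShift.{w} C
    (AsSmall.up : C ⥤ AsSmall.{w} C).CommShift ℤ :=
  let _ := asSmallHasShift.{w} C
  let _ : (AsSmall.equiv : C ≌ AsSmall.{w} C).inverse.CommShift ℤ :=
    Functor.CommShift.ofHasShiftOfFullyFaithful (AsSmall.equiv (C := C)).fullyFaithfulInverse
      (fun n => AsSmall.down ⋙ shiftFunctor C n ⋙ AsSmall.up) (fun _ => Iso.refl _)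
  (AsSmall.equiv : C ≌ AsSmall.{w} C).commShiftFunctor ℤ

end AsSmall

variable {T : Type u} [Category.{v} T] [Preadditive T] [HasZeroObject T] [HasShift T ℤ]
  [∀ n : ℤ, (shiftFunctor T n).Additive] [Pretriangulated T]
  {𝔄 : Type u'} [Category.{v'} 𝔄] [Abelian 𝔄] [HasShift 𝔄 ℤ]

lemma isHomological_comp {B : Type*} [Category* B] [Abelian B] (G : T ⥤ 𝔄) [G.IsHomological]
    (K : 𝔄 ⥤ B) [PreservesFiniteLimits K] [PreservesFiniteColimits K] :
    (G ⋙ K).IsHomological := by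
  have : K.PreservesZeroMorphisms := inferInstance
  have : (G ⋙ K).PreservesZeroMorphisms := inferInstance
  exact ⟨fun S hS => (G.map_distinguished_exact S hS).map K⟩

/-- The properties of the universal `I`-exact functor that enter the classification of
liftings: `I`-projective objects correspond to enough projective objects of `𝔄`, and `F` is fully
faithful on morphisms out of `I`-projective objects. -/
structure ResolvesByProjectives (I : MorphismIdeal T) (F : T ⥤ 𝔄) : Prop
    extends DetectsProjectives I F where
  full : ∀ ⦃P : T⦄, I.IsProjectiveObj P → ∀ ⦃X : T⦄ (h : F.obj P ⟶ F.obj X), ∃ t, F.map t = h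
  projective : ∀ ⦃P : T⦄, I.IsProjectiveObj P → Projective (F.obj P)
  cover : ∀ A : 𝔄, ∃ (P : T) (_ : I.IsProjectiveObj P) (p : F.obj P ⟶ A), Epi p

namespace MorphismIdeal.IsStableHomological

variable {I : MorphismIdeal T} (hI : IsStableHomological.{w₁, w₂} I)
include hI

lemma shift_mem {X Y : T} {f : X ⟶ Y} (hf : f ∈ I.hom X Y) (n : ℤ) :
    f⟦n⟧' ∈ I.hom (X⟦n⟧) (Y⟦n⟧) := by
  obtain ⟨B, _, _, _, G, _, _, hG⟩ := hI
  exact (hG _).2 (map_shift_eq_zero G ((hG f).1 hf) n)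

lemma isProjectiveObj_shift {P : T} (hP : I.IsProjectiveObj P) (n : ℤ) :
    I.IsProjectiveObj (P⟦n⟧) := fun X Y g f hf => by
  have h₀ : (shiftFunctorCompIsoId T n (-n) (by simp)).inv.app P ≫ g⟦-n⟧' ≫ f⟦-n⟧' = 0 := by
    rw [← Category.assoc]
    exact hP _ _ (hI.shift_mem hf _)
  rw [← Functor.map_comp, Preadditive.IsIso.comp_left_eq_zero] at h₀
  exact (shiftFunctor T (-n)).map_injective (h₀.trans
    ((shiftFunctor T (-n)).map_zero (P⟦n⟧) Y).symm)

end MorphismIdeal.IsStableHomological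

namespace Presented

variable {I : MorphismIdeal T} {F : T ⥤ 𝔄} [F.CommShift ℤ] [F.IsHomological]

/-- Forgetting the liftable morphisms recovers `F` from its lift. -/
def liftForgetIso (hF : DetectsProjectives I F) : F ≅ lift hF ⋙ forget I F :=
  NatIso.ofComponents (fun X => Iso.refl (F.obj X))
    (fun _ => (Category.comp_id _).trans (Category.id_comp _).symm)

lemma commShift_liftForgetIso (hF : DetectsProjectives I F) :
    let _ := hasShift hF
    let _ := liftCommShift hF
    let _ := forgetCommShift hF
    NatTrans.CommShift (liftForgetIso hF).hom ℤ := by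
  intro _ _ _
  refine ⟨fun n => ?_⟩
  ext X
  have h₁ : (F.commShiftIso n).hom.app X ≫ ((liftForgetIso hF).hom.app X)⟦n⟧' =
      (F.commShiftIso n).hom.app X :=
    (congrArg _ ((shiftFunctor 𝔄 n).map_id (F.obj X))).trans (Category.comp_id _)
  refine h₁.trans ?_
  refine Eq.symm ((Category.id_comp _).trans ?_)
  rw [Functor.commShiftIso_comp_hom_app]
  exact Category.comp_id _

end Presented

namespace IsUniversalExact

variable {I : MorphismIdeal T} {F : T ⥤ 𝔄} [F.CommShift ℤ] [F.IsHomological]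

/-- The universal functor is faithful on morphisms out of `I`-projective objects: the functor
that detects morphisms out of `P` factors through it. -/
lemma detectsProjectives (hF : IsUniversalExact I F) (hI : I.IsStableHomological)
    (hproj : I.EnoughProjectiveObjs) : DetectsProjectives I F where
  enough := hproj
  map_eq_zero := hF.map_eq_zero
  shift := fun _ hP n => hI.isProjectiveObj_shift hP n
  eq_zero P X hP t ht := by
    obtain ⟨B, _, _, _, G, _, _, hG⟩ := exists_stable_functor_detecting.{max u' v'} P
    obtain ⟨H, _, _, _, e, -⟩ := hF.exists_factorization B G (fun X Y f hf => (hG f).2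
      (fun n g => hP _ _ (hI.shift_mem hf n)))
    have h₀ : G.map t = 0 := by
      rw [← cancel_epi (e.hom.app P), ← e.hom.naturality t, Functor.comp_map, ht, comp_zero,
        H.map_zero, zero_comp]
    have h₁ := (hG t).1 h₀ 0 ((shiftFunctorZero T ℤ).inv.app P)
    have h₂ := (shiftFunctorZero T ℤ).inv.naturality t
    rw [← h₂, Preadditive.IsIso.comp_right_eq_zero] at h₁
    exact h₁

/-- The universal functor factors through the category of presented objects, and this
factorization is a section of the forgetful functor. -/
lemma exists_section (hF : IsUniversalExact I F) (hF' : DetectsProjectives I F) :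
    ∃ (H : 𝔄 ⥤ Presented I F) (_ : ∀ {X Y : 𝔄} (f : X ⟶ Y) [Epi f], Epi (H.map f)),
      Nonempty (F ⋙ H ≅ Presented.lift hF') ∧ Nonempty (H ⋙ Presented.forget I F ≅ 𝟭 𝔄) := by
  let _ := Presented.abelian hF'
  let _ := Presented.hasShift hF'
  let _ := Presented.liftCommShift hF'
  let _ := Presented.forgetCommShift hF'
  have := Presented.preservesFiniteLimits_forget hF'
  have := Presented.preservesFiniteColimits_forget hF'
  let _ := asSmallHasShift.{max u v u' v'} 𝔄
  let _ := asSmallUpCommShift.{max u v u' v'} 𝔄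
  have : (Presented.lift hF' ⋙ Presented.forget I F).IsHomological :=
    inferInstanceAs F.IsHomological
  have := isHomological_of_comp (Presented.lift hF') (Presented.forget I F)
  obtain ⟨H, _, _, _, e, he⟩ := hF.exists_factorization (Presented I F) (Presented.lift hF')
    (fun X Y f hf => Presented.hom_ext (hF.map_eq_zero f hf))
  refine ⟨H, fun f _ => inferInstance, ⟨e⟩, ?_⟩
  -- The universal property only concerns targets in a fixed universe, so `𝔄` is replaced by an
  -- equivalent category in that universe.
  let up : 𝔄 ⥤ AsSmall.{max u v u' v'} 𝔄 := AsSmall.up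
  have : up.IsEquivalence := (AsSmall.equiv (C := 𝔄)).isEquivalence_functor
  let e₀ := Presented.liftForgetIso hF'
  have : NatTrans.CommShift e₀.hom ℤ := Presented.commShift_liftForgetIso hF'
  have := isHomological_comp (Presented.lift hF') (Presented.forget I F ⋙ up)
  obtain ⟨i⟩ := hF.factorization_unique (AsSmall.{max u v u' v'} 𝔄)
    (Presented.lift hF' ⋙ Presented.forget I F ⋙ up) up (H ⋙ Presented.forget I F ⋙ up)
    (Functor.isoWhiskerRight e₀ up ≪≫ Functor.associator _ _ _)
    ((Functor.associator _ _ _).symm ≪≫ Functor.isoWhiskerRight e (Presented.forget I F ⋙ up))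
    (by dsimp; infer_instance) (by dsimp; infer_instance)
  exact ⟨((Functor.FullyFaithful.ofFullyFaithful up).whiskeringRight 𝔄).preimageIso
    ((Functor.associator _ _ _) ≪≫ i.symm ≪≫ up.leftUnitor.symm)⟩

/-- The universal functor restricts to an equivalence between the `I`-projective objects and
a class of projective objects of `𝔄` that is sufficiently large. -/
lemma resolvesByProjectives (hF : IsUniversalExact I F) (hI : I.IsStableHomological)
    (hproj : I.EnoughProjectiveObjs) : ResolvesByProjectives I F := by
  have hF' := hF.detectsProjectives hI hproj
  obtain ⟨H, hH, ⟨e⟩, ⟨i⟩⟩ := hF.exists_section hF'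
  have hHf : H.Faithful := by
    have : (H ⋙ Presented.forget I F).Faithful := Functor.Faithful.of_iso i.symm
    exact Functor.Faithful.of_comp _ (Presented.forget I F)
  refine { hF' with full := ?_, projective := ?_, cover := ?_ }
  · intro P hP X h
    -- `H(h)` sends the liftable morphism `𝟙` of `F(P)` to a liftable morphism `F(P) ⟶ F(X)`.
    obtain ⟨t, ht⟩ := Presented.hom_mem (e.inv.app P ≫ H.map h ≫ e.hom.app X) hP ⟨𝟙 P, rfl⟩
    refine ⟨t, H.map_injective ?_⟩
    have h₁ : (Presented.lift hF').map t = e.inv.app P ≫ H.map h ≫ e.hom.app X := by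
      refine Presented.hom_ext (ht.trans ?_)
      rw [F.map_id]
      exact Category.id_comp _
    have := e.hom.naturality t
    rw [h₁, Iso.hom_inv_id_app_assoc, cancel_mono] at this
    exact this
  · intro P hP
    refine ⟨fun {E X} f g _ => ?_⟩
    obtain ⟨l, -, hl⟩ := Presented.exists_mem_of_epi hF' (H.map g) hP
      (Presented.hom_mem (e.inv.app P ≫ H.map f) hP ⟨𝟙 P, rfl⟩)
    let ι (A : 𝔄) : (H.obj A).obj ≅ A := i.app A
    let ε : F.obj P ≅ (H.obj (F.obj P)).obj :=
      (Presented.liftForgetIso hF').app P ≪≫ (Presented.forget I F).mapIso (e.app P).symm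
    have h₁ : Presented.hom (H.map f) ≫ (ι X).hom = (ι (F.obj P)).hom ≫ f := i.hom.naturality f
    have h₂ : Presented.hom (H.map g) ≫ (ι X).hom = (ι E).hom ≫ g := i.hom.naturality g
    have h₃ : ε.hom ≫ Presented.hom (H.map f) = l ≫ Presented.hom (H.map g) := by
      refine Eq.trans ?_ hl
      rw [F.map_id]
      refine Eq.trans ?_ (Category.id_comp _).symm
      exact congrArg (· ≫ Presented.hom (H.map f)) (Category.id_comp _)
    refine ⟨(ι (F.obj P)).inv ≫ ε.inv ≫ l ≫ (ι E).hom, ?_⟩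
    simp only [Category.assoc]
    rw [← h₂, ← reassoc_of% h₃, Iso.inv_hom_id_assoc, h₁, Iso.inv_hom_id_assoc]
  · intro A
    have : Epi (i.hom.app A) := inferInstance
    exact ⟨_, (H.obj A).pres.projective, (H.obj A).pres.p ≫ i.hom.app A,
      @epi_comp _ _ _ _ _ (H.obj A).pres.p inferInstance (i.hom.app A) this⟩

end IsUniversalExact

end Universality

section Orthogonality

variable {T : Type u} [Category.{v} T] [Preadditive T] [HasZeroObject T] [HasShift T ℤ]
  [∀ n : ℤ, (shiftFunctor T n).Additive] [Pretriangulated T]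
  {𝔄 : Type u'} [Category.{v'} 𝔄] [Abelian 𝔄] [HasShift 𝔄 ℤ]

/-! ### Exact triangles -/

section Triangles

variable {X Y Z W : T} {f : X ⟶ Y} {g : Y ⟶ Z} {h : Z ⟶ X⟦(1 : ℤ)⟧}
  (hT : Triangle.mk f g h ∈ distTriang T)
include hT

lemma comp_eq_zero₁₂ : f ≫ g = 0 := comp_distTriang_mor_zero₁₂ _ hT

lemma comp_eq_zero₂₃ : g ≫ h = 0 := comp_distTriang_mor_zero₂₃ _ hT

lemma comp_eq_zero₃₁ : h ≫ f⟦(1 : ℤ)⟧' = 0 := comp_distTriang_mor_zero₃₁ _ hT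

lemma exists_desc₃_of_distTriang (s : Z ⟶ W) (hs : g ≫ s = 0) :
    ∃ s' : X⟦(1 : ℤ)⟧ ⟶ W, s = h ≫ s' :=
  Triangle.yoneda_exact₃ _ hT s hs

lemma exists_desc₁_of_distTriang (H : ∀ s : Z⟦(-1 : ℤ)⟧ ⟶ W, s = 0) (s : X ⟶ W) :
    ∃ s' : Y ⟶ W, s = f ≫ s' :=
  Triangle.yoneda_exact₂ _ (inv_rot_of_distTriang _ hT) s (H _)

variable (F : T ⥤ 𝔄) [F.CommShift ℤ] [F.IsHomological]

lemma map_exact₃ : (ShortComplex.mk (F.map g) (F.map h)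
    (by rw [← F.map_comp, comp_eq_zero₂₃ hT, F.map_zero])).Exact :=
  F.map_distinguished_exact _ (rot_of_distTriang _ hT)

lemma map_eq_zero_of_mono [Mono (F.map f)] : F.map h = 0 := by
  have h₁ : F.map h ≫ F.map (f⟦(1 : ℤ)⟧') = 0 := by
    rw [← F.map_comp, comp_eq_zero₃₁ hT, F.map_zero]
  have h₂ := h₁ =≫ (F.commShiftIso (1 : ℤ)).hom.app Y
  rw [Category.assoc, F.commShiftIso_hom_naturality f 1, zero_comp, ← Category.assoc] at h₂
  have h₃ := zero_of_comp_mono _ h₂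
  rwa [Preadditive.IsIso.comp_right_eq_zero] at h₃

/-- An exact triangle whose third map is killed by `F` yields a short exact sequence. -/
lemma map_shortExact (hh : F.map h = 0) : (ShortComplex.mk (F.map f) (F.map g)
    (by rw [← F.map_comp, comp_eq_zero₁₂ hT, F.map_zero])).ShortExact :=
  shortExact_of_map_eq_zero F _ hT hh

end Triangles

/-! ### Splitting of idempotents -/

/-- Idempotents split in a triangulated category with countable coproducts: the image of `e` is
the homotopy colimit of the sequence `P ⟶ P ⟶ P ⟶ ⋯` with all maps equal to `e`, that is, the cone
of `φ = 1 - shift`. Here `r` is a retraction of `φ`, so the map `g` to the cone is a split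
epimorphism. -/
lemma isIdempotentComplete [HasCountableCoproducts T] : IsIdempotentComplete T where
  idempotents_split P e he := by
    let i (n : ℕ) : P ⟶ ∐ fun _ : ℕ => P := Sigma.ι (fun _ => P) n
    let φ : (∐ fun _ : ℕ => P) ⟶ ∐ fun _ : ℕ => P := Sigma.desc fun n => i n - e ≫ i (n + 1)
    let r : (∐ fun _ : ℕ => P) ⟶ ∐ fun _ : ℕ => P :=
      Sigma.desc fun n => i n - e ≫ i n - ∑ k ∈ Finset.range n, e ≫ i k
    let q : (∐ fun _ : ℕ => P) ⟶ P := Sigma.desc fun _ => e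
    have hφ (n : ℕ) : i n ≫ φ = i n - e ≫ i (n + 1) := Sigma.ι_desc _ _
    have hr (n : ℕ) : i n ≫ r = i n - e ≫ i n - ∑ k ∈ Finset.range n, e ≫ i k :=
      Sigma.ι_desc _ _
    have hq (n : ℕ) : i n ≫ q = e := Sigma.ι_desc _ _
    have hφr : φ ≫ r = 𝟙 _ := by
      refine Sigma.hom_ext _ _ fun n => ?_
      change i n ≫ φ ≫ r = i n ≫ 𝟙 _
      rw [← Category.assoc, hφ, Preadditive.sub_comp, Category.assoc, hr, hr,
        Preadditive.comp_sub, Preadditive.comp_sub, ← Category.assoc e e, he, sub_self, zero_sub,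
        sub_neg_eq_add, Preadditive.comp_sum]
      simp only [← Category.assoc, he]
      rw [Finset.sum_range_succ, Category.comp_id]
      abel
    obtain ⟨Y, g, h, hT⟩ := distinguished_cocone_triangle φ
    have hφg : φ ≫ g = 0 := comp_distTriang_mor_zero₁₂ _ hT
    have h₀ : h = 0 := by
      have h₁ : h ≫ φ⟦(1 : ℤ)⟧' = 0 := comp_distTriang_mor_zero₃₁ _ hT
      have h₂ := h₁ =≫ r⟦(1 : ℤ)⟧'
      rwa [Category.assoc, ← Functor.map_comp, hφr, CategoryTheory.Functor.map_id, Category.comp_id,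
        zero_comp] at h₂
    have hg : Epi g := (Triangle.mor₃_eq_zero_iff_epi₂ _ hT).1 h₀
    have hφq : φ ≫ q = 0 := by
      refine Sigma.hom_ext _ _ fun n => ?_
      change i n ≫ φ ≫ q = i n ≫ 0
      rw [← Category.assoc, hφ, Preadditive.sub_comp, Category.assoc, hq, hq, he, sub_self,
        comp_zero]
    obtain ⟨q', hq'⟩ := exists_desc_of_distTriang hT q hφq
    have hig (n : ℕ) : i n ≫ g = e ≫ i (n + 1) ≫ g := by
      have := i n ≫= hφg
      rwa [← Category.assoc, hφ, Preadditive.sub_comp, comp_zero, sub_eq_zero,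
        Category.assoc] at this
    have heig (n : ℕ) : e ≫ i n ≫ g = i n ≫ g := by
      rw [hig n, ← Category.assoc e e, he]
    have hig₀ (n : ℕ) : i n ≫ g = i 0 ≫ g := by
      induction n with
      | zero => rfl
      | succ n ih => rw [← ih, hig n, heig (n + 1)]
    refine ⟨Y, q', i 0 ≫ g, ?_, ?_⟩
    · rw [← cancel_epi g, ← Category.assoc, ← hq', Category.comp_id]
      refine Sigma.hom_ext _ _ fun n => ?_
      change i n ≫ q ≫ i 0 ≫ g = i n ≫ g
      rw [← Category.assoc, hq, heig, hig₀ n]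
    · rw [Category.assoc, ← hq', hq]

/-! ### Orthogonality to contractible objects -/

namespace MorphismIdeal

variable (I : MorphismIdeal T)

/-- `X` is left orthogonal to the `I`-contractible objects. -/
def IsOrthogonal (X : T) : Prop := ∀ ⦃B : T⦄, I.IsContractibleObj B → ∀ f : X ⟶ B, f = 0

variable {I}

lemma IsProjectiveObj.isOrthogonal {P : T} (hP : I.IsProjectiveObj P) : I.IsOrthogonal P :=
  fun B hB f => by rw [← Category.comp_id f]; exact hP f _ hB

lemma IsProjectiveObj.of_retract {P Q : T} (hP : I.IsProjectiveObj P) (i : Q ⟶ P) (r : P ⟶ Q)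
    (h : i ≫ r = 𝟙 Q) : I.IsProjectiveObj Q := fun X Y g f hf => by
  rw [← Category.id_comp g, ← h, Category.assoc, Category.assoc, ← Category.assoc r, hP _ _ hf,
    comp_zero]

end MorphismIdeal

namespace ResolvesByProjectives

variable {I : MorphismIdeal T} {F : T ⥤ 𝔄} [F.CommShift ℤ] [F.IsHomological]
  (hF : ResolvesByProjectives I F)
include hF

/-- The ideal is the kernel of `F`: if `F(f) = 0`, then `f` vanishes on an `I`-epic map from an
`I`-projective object and hence factors through the cone of that map. -/
lemma mem_iff {X Y : T} (f : X ⟶ Y) : f ∈ I.hom X Y ↔ F.map f = 0 := by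
  refine ⟨hF.map_eq_zero f, fun h => ?_⟩
  obtain ⟨P, π, hP, C, ι, δ, hT, hι⟩ := hF.enough X
  obtain ⟨f', rfl⟩ := exists_desc_of_distTriang hT f
    (hF.eq_zero hP _ (by rw [F.map_comp, h, comp_zero]))
  exact I.postcomp hι f'

lemma isContractibleObj_shift {B : T} (hB : I.IsContractibleObj B) (n : ℤ) :
    I.IsContractibleObj (B⟦n⟧) := by
  have h := map_shift_eq_zero F (hF.map_eq_zero _ hB) n
  rw [CategoryTheory.Functor.map_id] at h
  exact (hF.mem_iff _).2 h

lemma isOrthogonal_shift {X : T} (hX : I.IsOrthogonal X) (n : ℤ) : I.IsOrthogonal (X⟦n⟧) :=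
  fun B hB f => by
    have h : (shiftFunctorCompIsoId T n (-n) (by simp)).inv.app X ≫ f⟦-n⟧' = 0 :=
      hX (hF.isContractibleObj_shift hB (-n)) _
    rw [Preadditive.IsIso.comp_left_eq_zero] at h
    exact (shiftFunctor T (-n)).map_injective
      (h.trans ((shiftFunctor T (-n)).map_zero (X⟦n⟧) B).symm)

lemma isOrthogonal₃ {X Y Z : T} {f : X ⟶ Y} {g : Y ⟶ Z} {h : Z ⟶ X⟦(1 : ℤ)⟧}
    (hT : Triangle.mk f g h ∈ distTriang T) (hX : I.IsOrthogonal X) (hY : I.IsOrthogonal Y) :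
    I.IsOrthogonal Z := fun B hB s => by
  obtain ⟨s', rfl⟩ := exists_desc₃_of_distTriang hT s (hY hB _)
  rw [hF.isOrthogonal_shift hX 1 hB s', comp_zero]

lemma isOrthogonal₁ {X Y Z : T} {f : X ⟶ Y} {g : Y ⟶ Z} {h : Z ⟶ X⟦(1 : ℤ)⟧}
    (hT : Triangle.mk f g h ∈ distTriang T) (hY : I.IsOrthogonal Y) (hZ : I.IsOrthogonal Z) :
    I.IsOrthogonal X := fun B hB s => by
  obtain ⟨s', rfl⟩ := exists_desc₁_of_distTriang hT (hF.isOrthogonal_shift hZ (-1) hB) s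
  rw [hY hB s', comp_zero]

/-- Between objects orthogonal to the contractible ones, `F` reflects isomorphisms: the cone
is contractible and orthogonal to itself. -/
lemma isIso_of_isIso_map {X Y : T} (hX : I.IsOrthogonal X) (hY : I.IsOrthogonal Y) (f : X ⟶ Y)
    [IsIso (F.map f)] : IsIso f := by
  obtain ⟨Z, g, h, hT⟩ := distinguished_cocone_triangle f
  refine (Triangle.isZero₃_iff_isIso₁ _ hT).1 ?_
  have hg : F.map g = 0 := by
    rw [← cancel_epi (F.map f), ← F.map_comp, comp_zero, comp_eq_zero₁₂ hT, F.map_zero]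
  have hZ : IsZero (F.obj Z) :=
    (map_exact₃ hT F).isZero_X₂ hg (map_eq_zero_of_mono hT F)
  have hZ' : I.IsContractibleObj Z := (hF.mem_iff _).2 (hZ.eq_of_src _ _)
  exact (IsZero.iff_id_eq_zero _).2 (hF.isOrthogonal₃ hT hX hY hZ' _)

/-- Every projective object of `𝔄` is the image of an `I`-projective object. -/
lemma exists_projective_iso [HasCountableCoproducts T] (Q : 𝔄) [Projective Q] :
    ∃ P : T, I.IsProjectiveObj P ∧ Nonempty (F.obj P ≅ Q) := by
  obtain ⟨P, hP, p, _⟩ := hF.cover Q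
  let s := Projective.factorThru (𝟙 Q) p
  have hs : s ≫ p = 𝟙 Q := Projective.factorThru_comp _ _
  obtain ⟨e, he⟩ := hF.full hP (p ≫ s)
  have hee : e ≫ e = e := by
    rw [← sub_eq_zero]
    refine hF.eq_zero hP _ ?_
    rw [F.map_sub, F.map_comp, he, Category.assoc, reassoc_of% hs, sub_self]
  obtain ⟨E, i, r, hir, hri⟩ := isIdempotentComplete.idempotents_split P e hee
  refine ⟨E, hP.of_retract i r hir, ⟨⟨F.map i ≫ p, s ≫ F.map r, ?_, ?_⟩⟩⟩
  · rw [Category.assoc, ← reassoc_of% he, ← F.map_comp, ← F.map_comp, ← hri]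
    simp [hir]
  · rw [Category.assoc, ← F.map_comp_assoc, hri, he]
    simp [hs]

/-- An object orthogonal to the contractible ones is `I`-projective if its image in `𝔄` is
projective: it is isomorphic to the `I`-projective object with the same image. -/
lemma isProjectiveObj_of_projective_map [HasCountableCoproducts T] {X : T} (hX : I.IsOrthogonal X)
    [Projective (F.obj X)] : I.IsProjectiveObj X := by
  obtain ⟨P, hP, ⟨e⟩⟩ := hF.exists_projective_iso (F.obj X)
  obtain ⟨t, ht⟩ := hF.full hP e.hom
  have : IsIso (F.map t) := by rw [ht]; infer_instance
  have := hF.isIso_of_isIso_map hP.isOrthogonal hX t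
  exact hP.of_retract (inv t) t (by simp)

end ResolvesByProjectives

end Orthogonality

section UniversalCoefficients

variable {T : Type u} [Category.{v} T] [Preadditive T] [HasZeroObject T] [HasShift T ℤ]
  [∀ n : ℤ, (shiftFunctor T n).Additive] [Pretriangulated T]
  {𝔄 : Type u'} [Category.{v'} 𝔄] [Abelian 𝔄] [HasShift 𝔄 ℤ] [HasExt.{w} 𝔄]

/-! ### The universal coefficient sequence -/

lemma shiftFunctor_additive (n : ℤ) : (shiftFunctor 𝔄 n).Additive :=
  Functor.additive_of_preserves_binary_products _

section ExtensionClass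

variable (F : T ⥤ 𝔄) [F.CommShift ℤ] [F.IsHomological]

/-- The class of the extension `F(X) ⟶ F(Y) ⟶ F(Z)` defined by an exact triangle
`X ⟶ Y ⟶ Z ⟶ X⟦1⟧` whose third map is killed by `F`. -/
def triangleClass {X Y Z : T} {f : X ⟶ Y} {g : Y ⟶ Z} {h : Z ⟶ X⟦(1 : ℤ)⟧}
    (hT : Triangle.mk f g h ∈ distTriang T) (hh : F.map h = 0) :
    Ext.{w} (F.obj Z) (F.obj X) 1 :=
  (map_shortExact hT F hh).extClass

/-- The extension of an exact triangle is natural for morphisms of the outer objects that are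
compatible with the third maps. -/
lemma triangleClass_naturality {X Y Z X' Y' Z' : T} {f : X ⟶ Y} {g : Y ⟶ Z} {h : Z ⟶ X⟦(1 : ℤ)⟧}
    {f' : X' ⟶ Y'} {g' : Y' ⟶ Z'} {h' : Z' ⟶ X'⟦(1 : ℤ)⟧}
    (hT : Triangle.mk f g h ∈ distTriang T) (hh : F.map h = 0)
    (hT' : Triangle.mk f' g' h' ∈ distTriang T) (hh' : F.map h' = 0)
    (a : X ⟶ X') (c : Z ⟶ Z') (comm : h ≫ a⟦(1 : ℤ)⟧' = c ≫ h') :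
    (triangleClass.{w} F hT hh).comp (Ext.mk₀ (F.map a)) (add_zero 1) =
      (Ext.mk₀ (F.map c)).comp (triangleClass.{w} F hT' hh') (zero_add 1) := by
  obtain ⟨b, hb₁, hb₂⟩ : ∃ b : Y ⟶ Y', f ≫ b = a ≫ f' ∧ g ≫ c = b ≫ g' :=
    complete_distinguished_triangle_morphism₂ _ _ hT hT' a c comm
  exact ShortComplex.ShortExact.extClass_naturality (map_shortExact hT F hh)
    (map_shortExact hT' F hh')
    { τ₁ := F.map a
      τ₂ := F.map b
      τ₃ := F.map c
      comm₁₂ := by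
        dsimp
        rw [← F.map_comp, ← F.map_comp, hb₁]
      comm₂₃ := by
        dsimp
        rw [← F.map_comp, ← F.map_comp, hb₂] }

lemma extensionClass_eq {X Y : T} (f : X ⟶ Y) (hf : F.map f = 0) :
    extensionClass.{w} F f hf = (triangleClass.{w} F (fibreTriangle_distinguished f)
      ((F.map_comp _ _).trans ((congrArg (· ≫ _) hf).trans zero_comp))).comp
        (Ext.mk₀ ((F.commShiftIso (-1 : ℤ)).hom.app Y)) (add_zero 1) := rfl

/-- The extension class of `f` in terms of an exact triangle `Y⟦-1⟧ ⟶ E ⟶ X ⟶ Y` on `f`. -/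
lemma exists_extensionClass_eq_triangleClass {X Y : T} (f : X ⟶ Y) (hf : F.map f = 0) :
    ∃ (E : T) (i : Y⟦(-1 : ℤ)⟧ ⟶ E) (p : E ⟶ X) (q : X ⟶ Y⟦(-1 : ℤ)⟧⟦(1 : ℤ)⟧)
      (hT : Triangle.mk i p q ∈ distTriang T) (hq : F.map q = 0),
      p ≫ f = 0 ∧ extensionClass.{w} F f hf = (triangleClass.{w} F hT hq).comp
        (Ext.mk₀ ((F.commShiftIso (-1 : ℤ)).hom.app Y)) (add_zero 1) := by
  refine ⟨_, _, _, f ≫ (shiftFunctorCompIsoId T (-1 : ℤ) 1 (by simp)).inv.app Y,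
    fibreTriangle_distinguished f, _, ?_, extensionClass_eq F f hf⟩
  have h := comp_eq_zero₂₃ (fibreTriangle_distinguished f)
  have h' : (exists_fibre_triangle f).choose.2.2 ≫ f ≫
    (shiftFunctorCompIsoId T (-1 : ℤ) 1 (by simp)).inv.app Y = 0 := h
  rw [← Category.assoc, Preadditive.IsIso.comp_right_eq_zero] at h'
  exact h'

/-- The extension class of `δ ≫ k` for the third map `δ` of an exact triangle. -/
lemma extensionClass_of_triangle {X Y : T} (f : X ⟶ Y) (hf : F.map f = 0) {X₁ X₂ : T}
    {i : X₁ ⟶ X₂} {p : X₂ ⟶ X} {δ : X ⟶ X₁⟦(1 : ℤ)⟧}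
    (hT : Triangle.mk i p δ ∈ distTriang T) (hδ : F.map δ = 0) (k : X₁ ⟶ Y⟦(-1 : ℤ)⟧)
    (hk : δ ≫ k⟦(1 : ℤ)⟧' = f ≫ (shiftFunctorCompIsoId T (-1 : ℤ) 1 (by simp)).inv.app Y) :
    extensionClass.{w} F f hf = (triangleClass.{w} F hT hδ).comp
      (Ext.mk₀ (F.map k ≫ (F.commShiftIso (-1 : ℤ)).hom.app Y)) (add_zero 1) := by
  have h₀ : F.map (f ≫ (shiftFunctorCompIsoId T (-1 : ℤ) 1 (by simp)).inv.app Y) = 0 :=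
    (F.map_comp _ _).trans ((congrArg (· ≫ _) hf).trans zero_comp)
  have h := triangleClass_naturality.{w} F hT hδ (fibreTriangle_distinguished f) h₀ k (𝟙 X)
    (hk.trans (Category.id_comp _).symm)
  rw [F.map_id, Ext.mk₀_id_comp] at h
  rw [extensionClass_eq, ← h, Ext.comp_assoc_of_third_deg_zero, Ext.mk₀_comp_mk₀]

lemma extensionClass_naturality {X Y X' Y' : T} {f : X ⟶ Y} (hf : F.map f = 0) {f' : X' ⟶ Y'}
    (hf' : F.map f' = 0) (a : X ⟶ X') (b : Y ⟶ Y') (comm : f ≫ b = a ≫ f') :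
    (extensionClass.{w} F f hf).comp (Ext.mk₀ ((F.map b)⟦(-1 : ℤ)⟧')) (add_zero 1) =
      (Ext.mk₀ (F.map a)).comp (extensionClass.{w} F f' hf') (zero_add 1) := by
  have h₀ {X Y : T} {f : X ⟶ Y} (hf : F.map f = 0) :
      F.map (f ≫ (shiftFunctorCompIsoId T (-1 : ℤ) 1 (by simp)).inv.app Y) = 0 :=
    (F.map_comp _ _).trans ((congrArg (· ≫ _) hf).trans zero_comp)
  have hn := (shiftFunctorCompIsoId T (-1 : ℤ) 1 (by simp)).inv.naturality b
  dsimp only [Functor.id_map, Functor.comp_map] at hn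
  have h := triangleClass_naturality.{w} F (fibreTriangle_distinguished f) (h₀ hf)
    (fibreTriangle_distinguished f') (h₀ hf') (b⟦(-1 : ℤ)⟧') a (by
      rw [Category.assoc, ← hn, reassoc_of% comm])
  rw [extensionClass_eq, extensionClass_eq, Ext.comp_assoc_of_third_deg_zero, Ext.mk₀_comp_mk₀,
    ← F.commShiftIso_hom_naturality b (-1), ← Ext.mk₀_comp_mk₀,
    ← Ext.comp_assoc_of_third_deg_zero, h, Ext.comp_assoc_of_third_deg_zero]

lemma extensionClass_comp {X Y Z : T} {f : X ⟶ Y} (hf : F.map f = 0) (b : Y ⟶ Z)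
    (hfb : F.map (f ≫ b) = 0) :
    extensionClass.{w} F (f ≫ b) hfb =
      (extensionClass.{w} F f hf).comp (Ext.mk₀ ((F.map b)⟦(-1 : ℤ)⟧')) (add_zero 1) := by
  rw [extensionClass_naturality F hf hfb (𝟙 _) b (Category.id_comp _).symm, F.map_id,
    Ext.mk₀_id_comp]

lemma comp_extensionClass {X Y Z : T} (a : X ⟶ Y) {f : Y ⟶ Z} (hf : F.map f = 0)
    (haf : F.map (a ≫ f) = 0) :
    extensionClass.{w} F (a ≫ f) haf =
      (Ext.mk₀ (F.map a)).comp (extensionClass.{w} F f hf) (zero_add 1) := by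
  rw [← extensionClass_naturality F haf hf a (𝟙 _) (Category.comp_id _), F.map_id,
    (shiftFunctor 𝔄 (-1 : ℤ)).map_id, Ext.comp_mk₀_id]

/-- Additivity of the extension class: both summands are obtained from the pair
`X ⟶ Y ⊞ Y` by composition with a projection, and their sum by composition with the sum. -/
lemma extensionClass_add {X Y : T} {f g : X ⟶ Y} (hf : F.map f = 0) (hg : F.map g = 0)
    (hfg : F.map (f + g) = 0) :
    extensionClass.{w} F (f + g) hfg = extensionClass.{w} F f hf + extensionClass.{w} F g hg := by
  have := shiftFunctor_additive (𝔄 := 𝔄) (-1)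
  have h : F.map (biprod.lift f g) = 0 := by
    have : biprod.lift f g = f ≫ biprod.inl + g ≫ biprod.inr := by ext <;> simp
    rw [this, F.map_add, F.map_comp, F.map_comp, hf, hg, zero_comp, zero_comp, add_zero]
  have key (b : Y ⊞ Y ⟶ Y) (k : X ⟶ Y) (hk : F.map k = 0) (e : biprod.lift f g ≫ b = k) :
      extensionClass.{w} F k hk = (extensionClass.{w} F _ h).comp
        (Ext.mk₀ ((F.map b)⟦(-1 : ℤ)⟧')) (add_zero 1) := by
    subst e
    exact extensionClass_comp F h b hk
  rw [key biprod.fst f hf (by simp), key biprod.snd g hg (by simp),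
    key (biprod.fst + biprod.snd) (f + g) hfg (by simp), F.map_add, Functor.map_add,
    Ext.mk₀_add, Ext.comp_add]

end ExtensionClass

namespace ResolvesByProjectives

variable {I : MorphismIdeal T} {F : T ⥤ 𝔄} [F.CommShift ℤ] [F.IsHomological]
  (hF : ResolvesByProjectives I F)
include hF

omit [HasExt.{w} 𝔄] in
lemma exists_cover {X : T} (hX : I.IsOrthogonal X) :
    ∃ (K P : T) (φ : K ⟶ P) (π : P ⟶ X) (δ : X ⟶ K⟦(1 : ℤ)⟧), Triangle.mk φ π δ ∈ distTriang T ∧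
      I.IsProjectiveObj P ∧ F.map δ = 0 ∧ I.IsOrthogonal K := by
  obtain ⟨P, π, hP, hπ⟩ := hF.enough X
  obtain ⟨K, φ, δ, hT⟩ := distinguished_cocone_triangle₁ π
  have := hF.epi_map hπ
  refine ⟨K, P, φ, π, δ, hT, hP, ?_, hF.isOrthogonal₁ hT hP.isOrthogonal hX⟩
  rw [← cancel_epi (F.map π), ← F.map_comp, comp_eq_zero₂₃ hT, F.map_zero, comp_zero]

variable [HasCountableCoproducts T] {D : T} (hD : I.IsOrthogonal D)
  [HasProjectiveDimensionLT (F.obj D) 2]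
include hD

omit [HasExt.{w} 𝔄] in
lemma exists_projective_resolution :
    ∃ (P₂ P₁ : T) (φ : P₂ ⟶ P₁) (π : P₁ ⟶ D) (δ : D ⟶ P₂⟦(1 : ℤ)⟧),
      Triangle.mk φ π δ ∈ distTriang T ∧ I.IsProjectiveObj P₂ ∧ I.IsProjectiveObj P₁ ∧
        F.map δ = 0 := by
  obtain ⟨P₂, P₁, φ, π, δ, hT, hP₁, hδ, hP₂⟩ := hF.exists_cover hD
  have := hF.projective hP₁
  have : HasProjectiveDimensionLT (F.obj P₂) 1 :=
    (map_shortExact hT F hδ).hasProjectiveDimensionLT_X₁ 1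
      (inferInstanceAs (HasProjectiveDimensionLT (F.obj P₁) 1))
      (inferInstanceAs (HasProjectiveDimensionLT (F.obj D) 2))
  exact ⟨P₂, P₁, φ, π, δ, hT, hF.isProjectiveObj_of_projective_map hP₂, hP₁, hδ⟩

omit [HasExt.{w} 𝔄] in
/-- Surjectivity of `T(D, Y) ⟶ 𝔄(F(D), F(Y))` if `F(D)` has projective dimension at most one. -/
lemma exists_map_eq {Y : T} (h : F.obj D ⟶ F.obj Y) : ∃ t : D ⟶ Y, F.map t = h := by
  obtain ⟨P₂, P₁, φ, π, δ, hT, hP₂, hP₁, hδ⟩ := hF.exists_projective_resolution hD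
  have hφπ : F.map φ ≫ F.map π = 0 := by rw [← F.map_comp, comp_eq_zero₁₂ hT, F.map_zero]
  obtain ⟨s, hs⟩ := hF.full hP₁ (F.map π ≫ h)
  obtain ⟨t, rfl⟩ := exists_desc_of_distTriang hT s
    (hF.eq_zero hP₂ _ (by rw [F.map_comp, hs, reassoc_of% hφπ, zero_comp]))
  have : Epi (F.map π) := (map_shortExact hT F hδ).epi_g
  exact ⟨t, by rwa [F.map_comp, cancel_epi] at hs⟩

/-- Injectivity of the extension class: if the extension splits, then the splitting lifts to
`T` and shows that `f` vanishes. -/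
lemma eq_zero_of_extensionClass_eq_zero {Y : T} {f : D ⟶ Y} (hf : F.map f = 0)
    (h : extensionClass.{w} F f hf = 0) : f = 0 := by
  obtain ⟨E, i, p, q, hT, hq, hpf, he⟩ := exists_extensionClass_eq_triangleClass.{w} F f hf
  have h₁ : triangleClass.{w} F hT hq = 0 := by
    have h₃ := congrArg (fun x : Ext.{w} _ _ 1 => x.comp
      (Ext.mk₀ ((F.commShiftIso (-1 : ℤ)).inv.app Y)) (add_zero 1)) (he.symm.trans h)
    rw [Ext.comp_assoc_of_third_deg_zero, Ext.mk₀_comp_mk₀, Iso.hom_inv_id_app, Ext.zero_comp] at h₃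
    exact (Ext.comp_mk₀_id _).symm.trans h₃
  obtain ⟨s, hs⟩ := Ext.covariant_sequence_exact₃ _ (map_shortExact hT F hq) (Ext.mk₀ (𝟙 (F.obj D)))
    (zero_add 1) ((Ext.mk₀_id_comp _).trans h₁)
  obtain ⟨s, rfl⟩ := (Ext.mk₀_bijective _ _).2 s
  obtain ⟨t, rfl⟩ := hF.exists_map_eq hD s
  have h₂ : F.map (t ≫ p) = 𝟙 (F.obj D) := by
    rw [F.map_comp]
    exact (Ext.mk₀_bijective _ _).1 ((Ext.mk₀_comp_mk₀ _ _).symm.trans hs)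
  have : IsIso (F.map (t ≫ p)) := by rw [h₂]; infer_instance
  have := hF.isIso_of_isIso_map hD hD (t ≫ p)
  rw [← cancel_epi (t ≫ p), Category.assoc, hpf, comp_zero, comp_zero]

/-- Surjectivity of the extension class: every extension of `F(D)` is induced from the extension
given by a projective resolution of length one of `D`. -/
lemma exists_extensionClass_eq {Y : T} (η : Ext.{w} (F.obj D) ((F.obj Y)⟦(-1 : ℤ)⟧) 1) :
    ∃ (f : D ⟶ Y) (hf : F.map f = 0), extensionClass.{w} F f hf = η := by
  obtain ⟨P₂, P₁, φ, π, δ, hT, hP₂, hP₁, hδ⟩ := hF.exists_projective_resolution hD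
  have := hF.projective hP₁
  obtain ⟨x, hx⟩ := Ext.contravariant_sequence_exact₃ (map_shortExact hT F hδ) _ η
    (Ext.eq_zero_of_hasProjectiveDimensionLT _ 1 le_rfl) (add_zero 1)
  obtain ⟨h, rfl⟩ := (Ext.mk₀_bijective _ _).2 x
  obtain ⟨k, hk⟩ := hF.full hP₂ (h ≫ (F.commShiftIso (-1 : ℤ)).inv.app Y)
  let e : Y⟦(-1 : ℤ)⟧⟦(1 : ℤ)⟧ ≅ Y := (shiftFunctorCompIsoId T (-1 : ℤ) 1 (by simp)).app Y
  have hf : F.map (δ ≫ k⟦(1 : ℤ)⟧' ≫ e.hom) = 0 := by rw [F.map_comp, hδ, zero_comp]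
  refine ⟨δ ≫ k⟦(1 : ℤ)⟧' ≫ e.hom, hf, ?_⟩
  rw [extensionClass_of_triangle F _ hf hT hδ k]
  · rw [hk, Category.assoc, Iso.inv_hom_id_app]
    exact (congrArg (fun y => (triangleClass.{w} F hT hδ).comp (Ext.mk₀ y) (add_zero 1))
      (Category.comp_id h)).trans hx
  · have : e.hom ≫ (shiftFunctorCompIsoId T (-1 : ℤ) 1 (by simp)).inv.app Y = 𝟙 _ := e.hom_inv_id
    simp only [Category.assoc, this, Category.comp_id]

end ResolvesByProjectives

end UniversalCoefficients

section ConePresentations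

variable {T : Type u} [Category.{v} T] [Preadditive T] [HasZeroObject T] [HasShift T ℤ]
  [∀ n : ℤ, (shiftFunctor T n).Additive] [Pretriangulated T]
  {𝔄 : Type u'} [Category.{v'} 𝔄] [Abelian 𝔄] [HasShift 𝔄 ℤ]

/-! ### Presentations of liftings as cones -/

lemma exists_kernel_iso {X X' B A : 𝔄} {i : X ⟶ B} {i' : X' ⟶ B} {p : B ⟶ A} {w : i ≫ p = 0}
    {w' : i' ≫ p = 0} (hS : (ShortComplex.mk i p w).ShortExact)
    (hS' : (ShortComplex.mk i' p w').ShortExact) : ∃ e : X ≅ X', e.hom ≫ i' = i :=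
  ⟨IsLimit.conePointUniqueUpToIso hS.fIsKernel hS'.fIsKernel,
    IsLimit.conePointUniqueUpToIso_hom_comp hS.fIsKernel hS'.fIsKernel WalkingParallelPair.zero⟩

lemma exists_cokernel_iso {X B A A' : 𝔄} {i : X ⟶ B} {p : B ⟶ A} {p' : B ⟶ A'} {w : i ≫ p = 0}
    {w' : i ≫ p' = 0} (hS : (ShortComplex.mk i p w).ShortExact)
    (hS' : (ShortComplex.mk i p' w').ShortExact) : ∃ e : A ≅ A', p ≫ e.hom = p' :=
  ⟨IsColimit.coconePointUniqueUpToIso hS.gIsCokernel hS'.gIsCokernel,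
    IsColimit.comp_coconePointUniqueUpToIso_hom hS.gIsCokernel hS'.gIsCokernel
      WalkingParallelPair.one⟩

lemma shortExact_of_isos {X B A X' B' A' : 𝔄} {i : X ⟶ B} {p : B ⟶ A} {i' : X' ⟶ B'} {p' : B' ⟶ A'}
    {w : i ≫ p = 0} {w' : i' ≫ p' = 0} (e₁ : X ≅ X') (e₂ : B ≅ B') (e₃ : A ≅ A')
    (h₁ : e₁.hom ≫ i' = i ≫ e₂.hom) (h₂ : e₂.hom ≫ p' = p ≫ e₃.hom)
    (hS : (ShortComplex.mk i p w).ShortExact) : (ShortComplex.mk i' p' w').ShortExact :=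
  ShortComplex.shortExact_of_iso (ShortComplex.isoMk (S₁ := .mk i p w) (S₂ := .mk i' p' w')
    e₁ e₂ e₃ h₁ h₂) hS

variable {I : MorphismIdeal T} {F : T ⥤ 𝔄} {A : 𝔄}

/-- An exact triangle `D ⟶ P ⟶ L ⟶ D⟦1⟧` that lifts a given extension
`F(D) ⟶ F(P) ⟶ A`. -/
structure ConePresentation (L : Lifting I F A) {D P : T} (i : F.obj D ⟶ F.obj P)
    (p : F.obj P ⟶ A) where
  φ : D ⟶ P
  π : P ⟶ L.obj
  δ : L.obj ⟶ D⟦(1 : ℤ)⟧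
  distinguished : Triangle.mk φ π δ ∈ distTriang T
  map_φ : F.map φ = i
  map_π : F.map π ≫ L.iso.hom = p
  map_δ : F.map δ = 0

variable [F.CommShift ℤ] [F.IsHomological]

namespace ConePresentation

variable {L L' L₁ L₂ L₃ L₁' L₂' : Lifting I F A} {D P : T} {i : F.obj D ⟶ F.obj P}
  {p : F.obj P ⟶ A} {D' P' : T} {i' : F.obj D' ⟶ F.obj P'} {p' : F.obj P' ⟶ A}

lemma zero (c : ConePresentation L i p) : i ≫ p = 0 := by
  have h : F.map c.φ ≫ F.map c.π ≫ L.iso.hom = 0 := by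
    rw [← F.map_comp_assoc, comp_eq_zero₁₂ c.distinguished, F.map_zero, zero_comp]
  rwa [c.map_φ, c.map_π] at h

lemma shortExact (c : ConePresentation L i p) : (ShortComplex.mk i p c.zero).ShortExact :=
  shortExact_of_isos (Iso.refl _) (Iso.refl _) L.iso
    ((Category.id_comp _).trans (c.map_φ.symm.trans (Category.comp_id _).symm))
    ((Category.id_comp _).trans c.map_π.symm) (map_shortExact c.distinguished F c.map_δ)

lemma map_sub (c₁ : ConePresentation L₁ i p) (c₂ : ConePresentation L₂ i p) :
    F.map (c₂.φ - c₁.φ) = 0 := by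
  rw [F.map_sub, c₁.map_φ, c₂.map_φ, sub_self]

/-- The obstruction class of two liftings that are presented with the same extension
`F(D) ⟶ F(P) ⟶ A`. -/
def difference [HasExt.{w} 𝔄] (c₁ : ConePresentation L₁ i p) (c₂ : ConePresentation L₂ i p) :
    Ext.{w} A (A⟦(-1 : ℤ)⟧) 2 :=
  c₁.shortExact.extClass.comp ((extensionClass F (c₂.φ - c₁.φ) (c₁.map_sub c₂)).comp
    (Ext.mk₀ (p⟦(-1 : ℤ)⟧')) (add_zero 1)) (by norm_num)

lemma difference_add [HasExt.{w} 𝔄] (c₁ : ConePresentation L₁ i p) (c₂ : ConePresentation L₂ i p)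
    (c₃ : ConePresentation L₃ i p) :
    c₁.difference c₂ + c₂.difference c₃ = c₁.difference.{w} c₃ := by
  have h : F.map ((c₂.φ - c₁.φ) + (c₃.φ - c₂.φ)) = 0 := by
    rw [F.map_add, c₁.map_sub, c₂.map_sub, add_zero]
  have h' : extensionClass.{w} F (c₃.φ - c₁.φ) (c₁.map_sub c₃) = extensionClass.{w} F _ h := by
    congr 1
    abel
  rw [difference, difference, difference, h', extensionClass_add F (c₁.map_sub c₂) (c₂.map_sub c₃),
    Ext.add_comp, Ext.comp_add]

end ConePresentation

namespace Comparison

variable {L₁ L₂ : Lifting I F A} (c : Comparison L₁ L₂)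

/-- The first of the two exact triangles of a comparison. -/
def left : ConePresentation L₁ (F.map c.φ₁) c.toA where
  φ := c.φ₁
  π := c.π₁
  δ := c.δ₁
  distinguished := c.distinguished₁
  map_φ := rfl
  map_π := rfl
  map_δ := c.map_δ₁

/-- The second of the two exact triangles of a comparison. -/
def right : ConePresentation L₂ (F.map c.φ₁) c.toA where
  φ := c.φ₂
  π := c.π₂
  δ := c.δ₂
  distinguished := c.distinguished₂
  map_φ := c.map_φ.symm
  map_π := c.map_π.symm
  map_δ := by
    have : Mono (F.map c.φ₁) := c.left.shortExact.mono_f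
    rw [c.map_φ] at this
    exact map_eq_zero_of_mono c.distinguished₂ F

lemma obstructionClass_eq [HasExt.{w} 𝔄] : c.obstructionClass = c.left.difference.{w} c.right := by
  have h : c.syzygyClass = c.left.shortExact.extClass := by
    have h₁ := ShortComplex.ShortExact.extClass_naturality.{w} c.left.shortExact
      (map_shortExact c.distinguished₁ F c.map_δ₁)
      { τ₁ := 𝟙 _
        τ₂ := 𝟙 _
        τ₃ := L₁.iso.inv
        comm₁₂ := (Category.id_comp _).trans (Category.comp_id _).symm
        comm₂₃ := by
          dsimp [toA]
          simp }
    exact h₁.symm.trans (Ext.comp_mk₀_id _)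
  rw [obstructionClass, h]
  rfl

/-- Two exact triangles that lift the same extension form a comparison. -/
def ofConePresentations {D P : T} (hP : I.IsProjectiveObj P) {i : F.obj D ⟶ F.obj P}
    {p : F.obj P ⟶ A} (c₁ : ConePresentation L₁ i p) (c₂ : ConePresentation L₂ i p) :
    Comparison L₁ L₂ where
  D := D
  P := P
  projective := hP
  φ₁ := c₁.φ
  φ₂ := c₂.φ
  π₁ := c₁.π
  π₂ := c₂.π
  δ₁ := c₁.δ
  δ₂ := c₂.δ
  distinguished₁ := c₁.distinguished
  distinguished₂ := c₂.distinguished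
  map_φ := c₁.map_φ.trans c₂.map_φ.symm
  map_π := c₁.map_π.trans c₂.map_π.symm
  map_δ₁ := c₁.map_δ

end Comparison

/-! ### Obstruction classes -/

namespace ResolvesByProjectives

open ConePresentation

variable {L L' L₁ L₂ L₃ L₁' L₂' : Lifting I F A} {D P : T} {i : F.obj D ⟶ F.obj P}
  {p : F.obj P ⟶ A} {D' P' : T} {i' : F.obj D' ⟶ F.obj P'} {p' : F.obj P' ⟶ A}
  (hF : ResolvesByProjectives I F)
include hF

/-- A map between the projective covers of two liftings that lifts the identity of `A` extends to
a morphism of exact triangles. -/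
lemma exists_map_of_equivalence (hP : I.IsProjectiveObj P) (c : ConePresentation L i p)
    (c' : ConePresentation L' i' p') (u : P ⟶ P') (hu : F.map u ≫ p' = p) (ψ : L.obj ⟶ L'.obj)
    (hψ : F.map ψ ≫ L'.iso.hom = L.iso.hom) : ∃ v : D ⟶ D', c.φ ≫ u = v ≫ c'.φ := by
  have h : c.π ≫ ψ = u ≫ c'.π := by
    rw [← sub_eq_zero]
    refine hF.eq_zero hP _ ?_
    rw [F.map_sub, sub_eq_zero, ← cancel_mono L'.iso.hom, F.map_comp, F.map_comp, Category.assoc,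
      Category.assoc, hψ, c.map_π, c'.map_π, hu]
  refine exists_lift_of_distTriang c'.distinguished _ ?_
  rw [Category.assoc, ← h, ← Category.assoc, comp_eq_zero₁₂ c.distinguished, zero_comp]

/-- The obstruction class depends only on the equivalence classes of the two liftings. -/
lemma difference_eq_of_equivalence [HasExt.{w} 𝔄] (hP : I.IsProjectiveObj P)
    (c₁ : ConePresentation L₁ i p) (c₂ : ConePresentation L₂ i p)
    (c₁' : ConePresentation L₁' i' p') (c₂' : ConePresentation L₂' i' p')
    (ψ₁ : L₁.obj ⟶ L₁'.obj) (hψ₁ : F.map ψ₁ ≫ L₁'.iso.hom = L₁.iso.hom)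
    (ψ₂ : L₂.obj ⟶ L₂'.obj) (hψ₂ : F.map ψ₂ ≫ L₂'.iso.hom = L₂.iso.hom) :
    c₁.difference.{w} c₂ = c₁'.difference c₂' := by
  have := hF.projective hP
  have : Epi p' := c₁'.shortExact.epi_g
  have : Mono i' := c₁'.shortExact.mono_f
  obtain ⟨u, hu⟩ := hF.full hP (Projective.factorThru p p')
  replace hu : F.map u ≫ p' = p := by rw [hu, Projective.factorThru_comp]
  obtain ⟨v₁, hv₁⟩ := hF.exists_map_of_equivalence hP c₁ c₁' u hu ψ₁ hψ₁
  obtain ⟨v₂, hv₂⟩ := hF.exists_map_of_equivalence hP c₂ c₂' u hu ψ₂ hψ₂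
  have hv₁' : F.map v₁ ≫ i' = i ≫ F.map u := by
    rw [← c₁'.map_φ, ← F.map_comp, ← hv₁, F.map_comp, c₁.map_φ]
  have hv₂' : F.map v₂ ≫ i' = i ≫ F.map u := by
    rw [← c₂'.map_φ, ← F.map_comp, ← hv₂, F.map_comp, c₂.map_φ]
  have hv : F.map (v₂ - v₁) = 0 := by
    rw [F.map_sub, sub_eq_zero, ← cancel_mono i', hv₁', hv₂']
  have h₁ : F.map ((v₂ - v₁) ≫ c₂'.φ) = 0 := by rw [F.map_comp, hv, zero_comp]
  have h₂ : F.map (v₁ ≫ (c₂'.φ - c₁'.φ)) = 0 := by rw [F.map_comp, c₁'.map_sub c₂', comp_zero]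
  have h₃ : F.map ((c₂.φ - c₁.φ) ≫ u) = 0 := by rw [F.map_comp, c₁.map_sub c₂, zero_comp]
  have h₄ : F.map ((v₂ - v₁) ≫ c₂'.φ + v₁ ≫ (c₂'.φ - c₁'.φ)) = 0 := by
    rw [F.map_add, h₁, h₂, add_zero]
  have h₅ : extensionClass.{w} F _ h₃ = extensionClass.{w} F _ h₄ := by
    congr 1
    rw [Preadditive.sub_comp, hv₁, hv₂, Preadditive.sub_comp, Preadditive.comp_sub]
    abel
  -- `(φ₂ - φ₁) ≫ u` differs from `v₁ ≫ (φ₂' - φ₁')` by a morphism that factors through `φ₂'`, whose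
  -- extension class is killed by `p'⟦-1⟧` because `i' ≫ p' = 0`.
  have hp : p⟦(-1 : ℤ)⟧' = (F.map u)⟦(-1 : ℤ)⟧' ≫ p'⟦(-1 : ℤ)⟧' := by
    rw [← Functor.map_comp, hu]
  have h₀ : (F.map c₂'.φ)⟦(-1 : ℤ)⟧' ≫ p'⟦(-1 : ℤ)⟧' = 0 := by
    rw [← Functor.map_comp, c₂'.map_φ, c₂'.zero]
    exact Functor.map_zero _ _ _
  have h₆ : (extensionClass.{w} F _ (c₁.map_sub c₂)).comp (Ext.mk₀ (p⟦(-1 : ℤ)⟧')) (add_zero 1) =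
      (Ext.mk₀ (F.map v₁)).comp ((extensionClass.{w} F _ (c₁'.map_sub c₂')).comp
        (Ext.mk₀ (p'⟦(-1 : ℤ)⟧')) (add_zero 1)) (zero_add 1) := by
    rw [hp, ← Ext.mk₀_comp_mk₀, ← Ext.comp_assoc_of_third_deg_zero,
      ← extensionClass_comp F (c₁.map_sub c₂) u h₃, h₅, extensionClass_add F h₁ h₂, Ext.add_comp,
      extensionClass_comp F hv c₂'.φ h₁, Ext.comp_assoc_of_third_deg_zero, Ext.mk₀_comp_mk₀, h₀,
      Ext.mk₀_zero, Ext.comp_zero, zero_add, comp_extensionClass F v₁ (c₁'.map_sub c₂') h₂,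
      Ext.comp_assoc_of_third_deg_zero]
  have h₇ := ShortComplex.ShortExact.extClass_naturality.{w} c₁.shortExact c₁'.shortExact
    { τ₁ := F.map v₁
      τ₂ := F.map u
      τ₃ := 𝟙 A
      comm₁₂ := hv₁'
      comm₂₃ := hu.trans (Category.comp_id _).symm }
  have h₈ : c₁.shortExact.extClass.comp (Ext.mk₀ (F.map v₁)) (add_zero 1) =
    c₁'.shortExact.extClass := h₇.trans (Ext.mk₀_id_comp _)
  rw [difference, difference, h₆, ← h₈, Ext.comp_assoc_of_second_deg_zero]

lemma exists_conePresentation (L : Lifting I F A) :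
    ∃ (D P : T) (i : F.obj D ⟶ F.obj P) (p : F.obj P ⟶ A),
      Nonempty (ConePresentation L i p) ∧ I.IsProjectiveObj P ∧ I.IsOrthogonal D := by
  obtain ⟨D, P, φ, π, δ, hT, hP, hδ, hD⟩ := hF.exists_cover L.orthogonal
  exact ⟨D, P, F.map φ, F.map π ≫ L.iso.hom, ⟨⟨φ, π, δ, hT, rfl, rfl, hδ⟩⟩, hP, hD⟩

/-- The syzygy of an object of projective dimension at most two. -/
lemma hasProjectiveDimensionLT_two [HasProjectiveDimensionLE A 2] (hP : I.IsProjectiveObj P)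
    (c : ConePresentation L i p) : HasProjectiveDimensionLT (F.obj D) 2 := by
  have := hF.projective hP
  exact c.shortExact.hasProjectiveDimensionLT_X₁ 2
    (hasProjectiveDimensionLT_of_ge (F.obj P) 1 2 (by norm_num))
    (inferInstanceAs (HasProjectiveDimensionLT A 3))

/-- The cone of a lifting of an extension of `A` is a lifting of `A`. -/
lemma exists_lifting_of_shortExact (hD : I.IsOrthogonal D) (hP : I.IsOrthogonal P) (f : D ⟶ P)
    (hf : F.map f = i) {w : i ≫ p = 0} (hS : (ShortComplex.mk i p w).ShortExact) :
    ∃ L : Lifting I F A, ∃ c : ConePresentation L i p, c.φ = f := by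
  subst hf
  obtain ⟨Z, g, h, hT⟩ := distinguished_cocone_triangle f
  have : Mono (F.map f) := hS.mono_f
  have hh := map_eq_zero_of_mono hT F
  obtain ⟨e, he⟩ := exists_cokernel_iso (map_shortExact hT F hh) hS
  exact ⟨⟨Z, hF.isOrthogonal₃ hT hD hP, e⟩, ⟨f, g, h, hT, rfl, he, hh⟩, rfl⟩

variable [HasCountableCoproducts T]

/-- A presentation of one lifting gives presentations of all other liftings with the same extension
of `A`. -/
lemma nonempty_conePresentation (hP : I.IsProjectiveObj P) (hD : I.IsOrthogonal D)
    [HasProjectiveDimensionLT (F.obj D) 2] {w : i ≫ p = 0}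
    (hS : (ShortComplex.mk i p w).ShortExact) (L : Lifting I F A) :
    Nonempty (ConePresentation L i p) := by
  obtain ⟨π, hπ⟩ := hF.full hP (p ≫ L.iso.inv)
  have : Epi p := hS.epi_g
  obtain ⟨D', φ, δ, hT⟩ := distinguished_cocone_triangle₁ π
  have hδ : F.map δ = 0 := by
    have h := comp_eq_zero₂₃ hT
    have h' : F.map π ≫ F.map δ = 0 := by rw [← F.map_comp, h, F.map_zero]
    rw [hπ] at h'
    exact zero_of_epi_comp _ h'
  let c : ConePresentation L (F.map φ) p := ⟨φ, π, δ, hT, rfl, by rw [hπ]; simp, hδ⟩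
  obtain ⟨e, he⟩ := exists_kernel_iso hS c.shortExact
  obtain ⟨t, ht⟩ := hF.exists_map_eq hD e.hom
  have : IsIso (F.map t) := by rw [ht]; infer_instance
  have := hF.isIso_of_isIso_map hD (hF.isOrthogonal₁ hT hP.isOrthogonal L.orthogonal) t
  let t' : D ≅ D' := asIso t
  have h : (δ ≫ (inv t)⟦(1 : ℤ)⟧') ≫ t⟦(1 : ℤ)⟧' = 𝟙 _ ≫ δ := by
    rw [Category.assoc, ← Functor.map_comp, IsIso.inv_hom_id, CategoryTheory.Functor.map_id,
      Category.comp_id, Category.id_comp]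
  have hT' : Triangle.mk (t ≫ φ) π (δ ≫ (inv t)⟦(1 : ℤ)⟧') ∈ distTriang T :=
    isomorphic_distinguished _ hT _
      (Triangle.isoMk (Triangle.mk (t ≫ φ) π (δ ≫ (inv t)⟦(1 : ℤ)⟧')) (Triangle.mk φ π δ)
        t' (Iso.refl P) (Iso.refl L.obj) (Category.comp_id _)
        ((Category.comp_id _).trans (Category.id_comp _).symm) h)
  exact ⟨⟨t ≫ φ, π, _, hT', by rw [F.map_comp, ht, he], c.map_π, by
    rw [F.map_comp, hδ, zero_comp]⟩⟩

lemma nonempty_comparison [HasProjectiveDimensionLE A 2] (L₁ L₂ : Lifting I F A) :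
    Nonempty (Comparison L₁ L₂) := by
  obtain ⟨D, P, i, p, ⟨c₁⟩, hP, hD⟩ := hF.exists_conePresentation L₁
  have := hF.hasProjectiveDimensionLT_two hP c₁
  obtain ⟨c₂⟩ := hF.nonempty_conePresentation hP hD c₁.shortExact L₂
  exact ⟨.ofConePresentations hP c₁ c₂⟩

/-- If the obstruction class of two liftings vanishes, then they are equivalent. -/
lemma equivalent_of_difference_eq_zero [HasExt.{w} 𝔄] (hP : I.IsProjectiveObj P)
    (hD : I.IsOrthogonal D) [HasProjectiveDimensionLT (F.obj D) 2] (c₁ : ConePresentation L₁ i p)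
    (c₂ : ConePresentation L₂ i p) (h : c₁.difference.{w} c₂ = 0) :
    LiftingClass.mk L₁ = LiftingClass.mk L₂ := by
  have := hF.projective hP
  have : Epi p := c₁.shortExact.epi_g
  -- `Ext¹(F(P), A⟦-1⟧) = 0`, so the connecting map of the extension is injective.
  obtain ⟨x, hx⟩ := Ext.contravariant_sequence_exact₁ c₁.shortExact _ _ _ h
  have hx₀ : x = 0 := Ext.eq_zero_of_hasProjectiveDimensionLT (X := F.obj P) x 1 le_rfl
  have hx' : (extensionClass.{w} F _ (c₁.map_sub c₂)).comp (Ext.mk₀ (p⟦(-1 : ℤ)⟧')) (add_zero 1)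
      = 0 := hx.symm.trans (by rw [hx₀]; exact Ext.comp_zero _ _ _ _ _)
  have h₁ : F.map ((c₂.φ - c₁.φ) ≫ c₁.π) = 0 := by rw [F.map_comp, c₁.map_sub c₂, zero_comp]
  have hπ : (F.map c₁.π)⟦(-1 : ℤ)⟧' = p⟦(-1 : ℤ)⟧' ≫ L₁.iso.inv⟦(-1 : ℤ)⟧' := by
    rw [← Functor.map_comp, ← (Iso.eq_comp_inv _).2 c₁.map_π]
  have h₂ : (c₂.φ - c₁.φ) ≫ c₁.π = 0 := by
    refine hF.eq_zero_of_extensionClass_eq_zero.{w} hD h₁ ?_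
    rw [extensionClass_comp F (c₁.map_sub c₂), hπ, ← Ext.mk₀_comp_mk₀,
      ← Ext.comp_assoc_of_third_deg_zero, hx', Ext.zero_comp]
  rw [Preadditive.sub_comp, comp_eq_zero₁₂ c₁.distinguished, sub_zero] at h₂
  obtain ⟨ψ, hψ⟩ := exists_desc_of_distTriang c₂.distinguished _ h₂
  have hψ' : F.map ψ ≫ L₁.iso.hom = L₂.iso.hom := by
    have : Epi (F.map c₂.π) := by
      have h := c₂.map_π
      rw [← Iso.eq_comp_inv] at h
      rw [h]
      infer_instance
    rw [← cancel_epi (F.map c₂.π), ← F.map_comp_assoc, ← hψ, c₁.map_π, c₂.map_π]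
  have : IsIso (F.map ψ) := by
    rw [← Iso.eq_comp_inv] at hψ'
    rw [hψ']
    infer_instance
  have := hF.isIso_of_isIso_map L₂.orthogonal L₁.orthogonal ψ
  exact (Quotient.sound (s := Lifting.setoid I F A) ⟨asIso ψ, hψ'⟩).symm

/-- Every class in `Ext²(A, A⟦-1⟧)` is the obstruction class of two liftings, the first of which
is prescribed. -/
lemma exists_difference_eq [HasExt.{w} 𝔄] (hP : I.IsProjectiveObj P) (hD : I.IsOrthogonal D)
    [HasProjectiveDimensionLT (F.obj D) 2] (c₁ : ConePresentation L₁ i p)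
    (e : Ext.{w} A (A⟦(-1 : ℤ)⟧) 2) :
    ∃ (L₂ : Lifting I F A) (c₂ : ConePresentation L₂ i p), c₁.difference c₂ = e := by
  have := hF.projective hP
  -- `Ext²(F(P), -) = 0` and `Ext²(F(D), -) = 0`, so `e` comes from `Ext¹(F(D), F(P)⟦-1⟧)`.
  obtain ⟨η, hη⟩ := Ext.contravariant_sequence_exact₃ c₁.shortExact _ e
    (Ext.eq_zero_of_hasProjectiveDimensionLT (X := F.obj P) _ 1 (by norm_num)) (n₀ := 1) rfl
  have := shiftFunctor_additive (𝔄 := 𝔄) (-1)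
  obtain ⟨η', hη'⟩ := Ext.covariant_sequence_exact₃ (F.obj D)
    (c₁.shortExact.map_of_exact (shiftFunctor 𝔄 (-1 : ℤ))) η (n₁ := 2) rfl
    (Ext.eq_zero_of_hasProjectiveDimensionLT (X := F.obj D) _ 2 le_rfl)
  obtain ⟨ψ, hψ, hψ'⟩ := hF.exists_extensionClass_eq hD η'
  obtain ⟨L₂, c₂, hc₂⟩ := hF.exists_lifting_of_shortExact hD hP.isOrthogonal (c₁.φ + ψ)
    (by rw [F.map_add, hψ, add_zero, c₁.map_φ]) c₁.shortExact
  refine ⟨L₂, c₂, ?_⟩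
  have h : extensionClass.{w} F _ (c₁.map_sub c₂) = η' := by
    rw [← hψ']
    congr 1
    rw [hc₂, add_sub_cancel_left]
  rw [difference, h]
  exact (congrArg (fun y => Ext.comp _ y _) hη').trans hη

/-- Objects of projective dimension at most two admit liftings. -/
lemma nonempty_lifting [HasProjectiveDimensionLE A 2] : Nonempty (Lifting I F A) := by
  obtain ⟨P₀, hP₀, p, _⟩ := hF.cover A
  have hS : (ShortComplex.mk (kernel.ι p) p (kernel.condition p)).ShortExact :=
    { exact := ShortComplex.exact_kernel p }
  have := hF.projective hP₀
  have h₂ : HasProjectiveDimensionLT (kernel p) 2 :=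
    hS.hasProjectiveDimensionLT_X₁ 2
      (hasProjectiveDimensionLT_of_ge (F.obj P₀) 1 2 (by norm_num))
      (inferInstanceAs (HasProjectiveDimensionLT A 3))
  obtain ⟨P₁, hP₁, q, _⟩ := hF.cover (kernel p)
  have hS' : (ShortComplex.mk (kernel.ι q) q (kernel.condition q)).ShortExact :=
    { exact := ShortComplex.exact_kernel q }
  have := hF.projective hP₁
  have h₁ : HasProjectiveDimensionLT (kernel q) 1 :=
    hS'.hasProjectiveDimensionLT_X₁ 1
      (inferInstanceAs (HasProjectiveDimensionLT (F.obj P₁) 1)) h₂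
  obtain ⟨P₂, hP₂, ⟨e⟩⟩ := hF.exists_projective_iso (kernel q)
  obtain ⟨f, hf⟩ := hF.full hP₂ (e.hom ≫ kernel.ι q)
  have w₁ : (e.hom ≫ kernel.ι q) ≫ q = 0 := by simp
  obtain ⟨L, -⟩ := hF.exists_lifting_of_shortExact hP₂.isOrthogonal hP₁.isOrthogonal f hf (w := w₁)
    (shortExact_of_isos e.symm (Iso.refl _) (Iso.refl _) (by simp) (by simp) hS')
  have : HasProjectiveDimensionLT (F.obj L.obj) 2 := hasProjectiveDimensionLT_of_iso L.iso.symm 2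
  obtain ⟨t, ht⟩ := hF.exists_map_eq L.orthogonal (L.iso.hom ≫ kernel.ι p)
  have w₀ : (L.iso.hom ≫ kernel.ι p) ≫ p = 0 := by simp
  obtain ⟨L', -⟩ := hF.exists_lifting_of_shortExact L.orthogonal hP₀.isOrthogonal t ht (w := w₀)
    (shortExact_of_isos L.iso.symm (Iso.refl _) (Iso.refl _) (by simp) (by simp) hS)
  exact ⟨L'⟩

end ResolvesByProjectives

end ConePresentations

/-! ### The action on equivalence classes of liftings -/

section Action

/-- A difference function with values in an abelian group that is additive, separates points and
takes all values comes from a free and transitive action. -/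
lemma exists_addAction_of_difference {G S : Type*} [AddCommGroup G] (d : S → S → G)
    (hadd : ∀ x y z, d x y + d y z = d x z) (hzero : ∀ x y, d x y = 0 → x = y)
    (hsurj : ∀ x e, ∃ y, d x y = e) :
    ∃ _ : AddAction G S, (∀ x : S, Function.Bijective fun e : G => e +ᵥ x) ∧
      ∀ x y, d x y +ᵥ x = y := by
  have hself (x : S) : d x x = 0 := by simpa using hadd x x x
  have hinj (x y z : S) (h : d x y = d x z) : y = z := hzero _ _ (by
    have := hadd x y z
    rwa [h, add_eq_left] at this)
  choose act hact using hsurj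
  let _ : AddAction G S :=
    { vadd e x := act x e
      zero_vadd x := hinj x _ _ ((hact x 0).trans (hself x).symm)
      add_vadd e e' x := hinj x _ _ (by
        change d x (act x (e + e')) = d x (act (act x e') e)
        rw [hact, ← hadd x (act x e'), hact, hact, add_comm]) }
  have hd (x y : S) : d x y +ᵥ x = y := hinj x _ _ (hact x _)
  refine ⟨inferInstance, fun x => ⟨fun e e' h => ?_, fun y => ⟨d x y, hd x y⟩⟩, hd⟩
  have h' : act x e = act x e' := h
  rw [← hact x e, h', hact]

variable {T : Type u} [Category.{v} T] [Preadditive T] [HasZeroObject T] [HasShift T ℤ]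
  [∀ n : ℤ, (shiftFunctor T n).Additive] [Pretriangulated T]
  {𝔄 : Type u'} [Category.{v'} 𝔄] [Abelian 𝔄] [HasShift 𝔄 ℤ] [HasExt.{w} 𝔄]
  {I : MorphismIdeal T} {F : T ⥤ 𝔄} [F.CommShift ℤ] [F.IsHomological]
  [HasCountableCoproducts T]

namespace ResolvesByProjectives

/-- The obstruction class as a function on equivalence classes of liftings. -/
lemma exists_difference (hF : ResolvesByProjectives I F) (A : 𝔄) [HasProjectiveDimensionLE A 2] :
    ∃ d : LiftingClass I F A → LiftingClass I F A → Ext.{w} A (A⟦(-1 : ℤ)⟧) 2,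
      (∀ x y z, d x y + d y z = d x z) ∧ (∀ x y, d x y = 0 → x = y) ∧
      (∀ x e, ∃ y, d x y = e) ∧
      ∀ (L₁ L₂ : Lifting I F A) (c : Comparison L₁ L₂),
        d (.mk L₁) (.mk L₂) = c.obstructionClass := by
  let rep (x : LiftingClass I F A) : Lifting I F A := Quotient.out x
  have hrep (x : LiftingClass I F A) : LiftingClass.mk (rep x) = x := Quotient.out_eq x
  have hmk (L : Lifting I F A) : ∃ ψ : (rep (.mk L)).obj ⟶ L.obj,
      F.map ψ ≫ L.iso.hom = (rep (.mk L)).iso.hom := by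
    obtain ⟨ψ, h⟩ := Quotient.exact (hrep (.mk L))
    exact ⟨ψ.hom, h⟩
  let d (x y : LiftingClass I F A) : Ext.{w} A (A⟦(-1 : ℤ)⟧) 2 :=
    (hF.nonempty_comparison (rep x) (rep y)).some.obstructionClass
  have hd {L₁ L₂ : Lifting I F A} {D P : T} {i : F.obj D ⟶ F.obj P} {p : F.obj P ⟶ A}
      (c₁ : ConePresentation L₁ i p) (c₂ : ConePresentation L₂ i p) :
      d (.mk L₁) (.mk L₂) = c₁.difference c₂ := by
    obtain ⟨ψ₁, h₁⟩ := hmk L₁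
    obtain ⟨ψ₂, h₂⟩ := hmk L₂
    refine (Comparison.obstructionClass_eq _).trans ?_
    exact hF.difference_eq_of_equivalence (Comparison.projective _) _ _ c₁ c₂ ψ₁ h₁ ψ₂ h₂
  refine ⟨d, fun x y z => ?_, fun x y h => ?_, fun x e => ?_, fun L₁ L₂ c => ?_⟩
  · obtain ⟨D, P, i, p, ⟨c₁⟩, hP, hD⟩ := hF.exists_conePresentation (rep x)
    have := hF.hasProjectiveDimensionLT_two hP c₁
    obtain ⟨c₂⟩ := hF.nonempty_conePresentation hP hD c₁.shortExact (rep y)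
    obtain ⟨c₃⟩ := hF.nonempty_conePresentation hP hD c₁.shortExact (rep z)
    rw [← hrep x, ← hrep y, ← hrep z, hd c₁ c₂, hd c₂ c₃, hd c₁ c₃, c₁.difference_add]
  · obtain ⟨D, P, i, p, ⟨c₁⟩, hP, hD⟩ := hF.exists_conePresentation (rep x)
    have := hF.hasProjectiveDimensionLT_two hP c₁
    obtain ⟨c₂⟩ := hF.nonempty_conePresentation hP hD c₁.shortExact (rep y)
    rw [← hrep x, ← hrep y] at h ⊢
    rw [hd c₁ c₂] at h
    exact hF.equivalent_of_difference_eq_zero hP hD c₁ c₂ h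
  · obtain ⟨D, P, i, p, ⟨c₁⟩, hP, hD⟩ := hF.exists_conePresentation (rep x)
    have := hF.hasProjectiveDimensionLT_two hP c₁
    obtain ⟨L₂, c₂, h⟩ := hF.exists_difference_eq hP hD c₁ e
    refine ⟨.mk L₂, ?_⟩
    rw [← hrep x, hd c₁ c₂, h]
  · rw [hd c.left c.right, c.obstructionClass_eq]

end ResolvesByProjectives

end Action

end TriangulatedLifting

end

theorem mainTheorem1
    {T : Type u} [Category.{v} T] [Preadditive T] [HasZeroObject T] [HasShift T ℤ]
    [∀ n : ℤ, (shiftFunctor T n).Additive] [Pretriangulated T] [IsTriangulated T]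
    [HasCountableCoproducts T]
    (I : MorphismIdeal T)
    (hI : MorphismIdeal.IsStableHomological.{w₁, w₂} I)
    (hcoprod : I.CompatibleWithCountableCoproducts)
    (hproj : I.EnoughProjectiveObjs)
    {𝔄 : Type u'} [Category.{v'} 𝔄] [Abelian 𝔄] [HasShift 𝔄 ℤ] [HasExt.{w} 𝔄]
    (F : T ⥤ 𝔄) [F.CommShift ℤ] [F.IsHomological]
    (hF : IsUniversalExact I F)
    (A : 𝔄) (hA : HasProjectiveDimensionLE A 2) :
    Nonempty (LiftingClass I F A ≃ Ext.{w} A (A⟦(-1 : ℤ)⟧) 2) ∧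
    ∃ _ : AddAction (Ext.{w} A (A⟦(-1 : ℤ)⟧) 2) (LiftingClass I F A),
      (∀ x : LiftingClass I F A, Function.Bijective
        (fun e : Ext.{w} A (A⟦(-1 : ℤ)⟧) 2 => e +ᵥ x)) ∧
      ∀ L₁ L₂ : Lifting I F A, Nonempty (Comparison L₁ L₂) ∧
        ∀ c : Comparison L₁ L₂,
          c.obstructionClass +ᵥ LiftingClass.mk L₁ = LiftingClass.mk L₂ := by
  have hF' := hF.resolvesByProjectives hI hproj
  obtain ⟨d, hadd, hzero, hsurj, hd⟩ := hF'.exists_difference A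
  obtain ⟨act, hbij, hact⟩ := exists_addAction_of_difference d hadd hzero hsurj
  obtain ⟨L⟩ : Nonempty (Lifting I F A) := hF'.nonempty_lifting
  refine ⟨⟨(Equiv.ofBijective _ (hbij (.mk L))).symm⟩, act, hbij, fun L₁ L₂ =>
    ⟨hF'.nonempty_comparison L₁ L₂, fun c => ?_⟩⟩
  rw [← hd L₁ L₂ c, hact]
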